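/- **Setting.** Let $\rho_0,\lambda_0,\mu_0,\omega>0$, $c_P=\sqrt{(\lambda_0+2\mu_0)/\rho_0}$, $c_S=\sqrt{\mu_0/\rho_0}$, $\kappa_\alpha=\omega/c_\alpha$ for $\alpha\in\{P,S\}$. Let $H^{(1)}_n=J_n+iY_n$ be the Hankel function of the first kind, $(H^{(1)}_n)'$ its derivative with respect to its argument, and for $x\in\mathbb R^2\setminus\{0\}$ with polar angle $\varphi_x$ put $$v_n(x,\kappa)=H^{(1)}_n(\kappa|x|)e^{in\varphi_x},\qquad \mathbf H^P_n=\nabla v_n(\cdot,\kappa_P),\qquad \mathbf H^S_n=(\partial_2,-\partial_1)^\top v_n(\cdot,\kappa_S).$$ Let $K\ge 0$ and $N_s,N_r$ be integers, and $\delta\in\mathbb R$. The receivers are $x_r=R(\cos\theta_r,\sin\theta_r)$ with $\theta_r=2\pi r/N_r$, $1\le r\le N_r$, and $\{d_r,d_r^\perp\}$ is, for each $r$, an orthonormal pair of vectors of $\mathbb R^2$ independent of $R$ (for instance $d_r=x_r/R$). The directions of incidence have the angles $\theta_s+\delta$ with $\theta_s=2\pi s/N_s$, $1\le s\le N_s$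 (for instance $\delta=0$ or $\delta=\pi$). For $|m|,|n|\le K$ and $\alpha\in\{P,S\}$ put $$(\mathbf X^\alpha)_{sm}=\frac{1}{(2\rho_0\omega c_\alpha)^2\kappa_\alpha}e^{im(\pi/2-\theta_s-\delta)},\qquad (\mathbf Y^\alpha_\parallel)_{rn}=\overline{\mathbf H^\alpha_n(x_r)}\cdot d_r,\qquad (\mathbf Y^\alpha_\perp)_{rn}=\overline{\mathbf H^\alpha_n(x_r)}\cdot d_r^\perp,$$ $$\mathbf X=\begin{pmatrix}\mathbf X^P&0\\0&\mathbf X^S\end{pmatrix},\qquad \mathbf Y=\begin{pmatrix}\mathbf Y^P_\parallel&\mathbf Y^S_\parallel\\ \mathbf Y^P_\perp&\mathbf Y^S_\perp\end{pmatrix},\qquad \mathbf L_R(M)=\mathbf XM\mathbf Y^*,\quad M\in\mathbb C^{(4K+2)\times(4K+2)}.$$ Spaces of matrices carry the Frobenius inner product $\langle M,N\rangle=\sum_{k,l}\overline{M_{kl}}N_{kl}$, and $\mathbf V_{pq}$, $1\le p,q\le 4K+2$, are the canonical matrix units. An index $p\le 2K+1$ has mode $P$ and order $p-1-K$; an index $p\ge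 2K+2$ has mode $S$ and order $p-2-3K$. If $p$ has mode $\alpha$, and $q$ has mode $\beta$ and order $n$, put $$\sigma_{pq}(R)=\sqrt{N_sN_r}\;\frac{\kappa_\beta\,\bigl|(H^{(1)}_n)'(\kappa_\beta R)\bigr|}{4\rho_0^2\omega^2c_\alpha^2\kappa_\alpha}.$$ In particular, for $\alpha=\beta$ (both indices in the first, $P$, block, or both in the second, $S$, block), $$\sigma_{pq}(R)=\frac{\sqrt{N_sN_r}}{4\rho_0^2\omega^2c_\alpha^2\kappa_\alpha}\left|\frac{d}{dR}H^{(1)}_n(\kappa_\alpha R)\right|.$$ **Theorem 4.4.** Let $N_s,N_r\ge 2K+1$. As $R\to+\infty$, with all other data fixed, the right singular vectors of $\mathbf L_R$ are the canonical matrix units $\mathbf V_{pq}$, with the singular values $\sigma_{pq}(R)$, in the following sense. 1. For all $p,q,p',q'$, $$\langle\mathbf L_R(\mathbf V_{pq}),\mathbf L_R(\mathbf V_{p'q'})\rangle=\delta_{pp'}\delta_{qq'}\,\sigma_{pq}(R)^2+O(R^{-2}).$$ 2. For all sufficiently large $R$ the operator $\mathbf L_R$ has a singular value decomposition $\mathbf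 L_R=\sum_{p,q}s_{pq}(R)\,\langle V_{pq}(R),\cdot\rangle\,U_{pq}(R)$, with $s_{pq}(R)\ge0$, with orthonormal left singular vectors $U_{pq}(R)$ and with an orthonormal basis $(V_{pq}(R))_{p,q}$ of $\mathbb C^{(4K+2)\times(4K+2)}$ of right singular vectors, such that for all $p,q$ $$V_{pq}(R)=\mathbf V_{pq}+O(R^{-1}),\qquad \frac{s_{pq}(R)}{\sigma_{pq}(R)}=1+O(R^{-1}).$$ -/

import Mathlib

open Real Filter Topology Asymptotics MeasureTheory

noncomputable section

/-! ### Cylindrical functions of integer order -/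

/-- The Bessel function of the first kind `J_n(x)` of integer order, by Bessel's integral. -/
def besselJ (n : ℤ) (x : ℝ) : ℝ :=
  (1 / π) * ∫ θ in (0 : ℝ)..π, Real.cos (x * Real.sin θ - n * θ)

/-- The Bessel function of the second kind `Y_n(x)` of integer order at `x > 0`,
by Schläfli's integral (both integrals converge absolutely for `x > 0`). -/
def besselY (n : ℤ) (x : ℝ) : ℝ :=
  (1 / π) * (∫ θ in (0 : ℝ)..π, Real.sin (x * Real.sin θ - n * θ)) -
    (1 / π) * ∫ t in Set.Ioi (0 : ℝ),
      (Real.exp (n * t) + (-1) ^ n * Real.exp (-(n * t))) * Real.exp (-(x * Real.sinh t))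

/-- The Hankel function of the first kind, `H⁽¹⁾_n = J_n + i Y_n`, on the positive half-line. -/
def hankel1 (n : ℤ) (x : ℝ) : ℂ := (besselJ n x : ℂ) + Complex.I * (besselY n x : ℂ)

/-! ### The background medium -/

/-- The background elastic medium: mass density `ρ`, compressional modulus `lam` and shear modulus
`mu`, together with the angular frequency `ω`; all of them positive. -/
structure ElasticBackground where
  ρ : ℝ
  lam : ℝ
  mu : ℝ
  ω : ℝ
  ρ_pos : 0 < ρ
  lam_pos : 0 < lam
  mu_pos : 0 < mu
  ω_pos : 0 < ω

/-- The two wave modes: pressure and shear. -/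
inductive WaveMode : Type
  | P : WaveMode
  | S : WaveMode

namespace ElasticBackground

/-- The wave speeds `c_P = √((λ + 2μ)/ρ)` and `c_S = √(μ/ρ)`. -/
def c (B : ElasticBackground) : WaveMode → ℝ
  | .P => √((B.lam + 2 * B.mu) / B.ρ)
  | .S => √(B.mu / B.ρ)

/-- The wave numbers `κ_α = ω / c_α`. -/
def κ (B : ElasticBackground) (α : WaveMode) : ℝ := B.ω / B.c α

end ElasticBackground

/-! ### Cylindrical elastic waves in the plane -/

/-- The Euclidean plane. -/
abbrev Plane : Type := EuclideanSpace ℝ (Fin 2)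

/-- The point with polar coordinates `(R, θ)`. -/
def polarPoint (R θ : ℝ) : Plane := !₂[R * Real.cos θ, R * Real.sin θ]

/-- The polar angle of `x`, in `(-π, π]`; it only enters through `exp (i n φ_x)` with `n` an
integer, so that the choice of the branch is irrelevant. -/
def polarAngle (x : Plane) : ℝ := Complex.arg ((x 0 : ℂ) + (x 1 : ℂ) * Complex.I)

/-- The outgoing cylindrical wave `v_n(x, κ) = H⁽¹⁾_n(κ |x|) exp (i n φ_x)`. -/
def cylindricalWave (n : ℤ) (κ : ℝ) (x : Plane) : ℂ :=
  hankel1 n (κ * ‖x‖) * Complex.exp (Complex.I * n * polarAngle x)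

/-- The partial derivative `∂_j f` of a complex valued function on the plane. -/
def partialDeriv (j : Fin 2) (f : Plane → ℂ) (x : Plane) : ℂ :=
  fderiv ℝ f x (EuclideanSpace.single j 1)

/-- The gradient `(∂₁ f, ∂₂ f)`. -/
def planeGrad (f : Plane → ℂ) (x : Plane) : Fin 2 → ℂ :=
  ![partialDeriv 0 f x, partialDeriv 1 f x]

/-- The vector curl `(∂₂ f, -∂₁ f)` of a scalar function. -/
def planeCurl (f : Plane → ℂ) (x : Plane) : Fin 2 → ℂ :=
  ![partialDeriv 1 f x, -partialDeriv 0 f x]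

/-- The exterior cylindrical elastic waves: `H^P_n = ∇ v_n(·, κ_P)` (longitudinal) and
`H^S_n = curl v_n(·, κ_S)` (transverse). -/
def cylindricalElasticWave (B : ElasticBackground) : WaveMode → ℤ → Plane → Fin 2 → ℂ
  | .P, n => planeGrad (cylindricalWave n (B.κ .P))
  | .S, n => planeCurl (cylindricalWave n (B.κ .S))

/-! ### The MSR operator -/

/-- The orders `-K, …, K` of the retained modes, enumerated increasingly. -/
def modeOrder (K : ℕ) (i : Fin (2 * K + 1)) : ℤ := (i : ℤ) - K

/-- The index set of the `4K+2` retained modes: the P-modes come first, then the S-modes. -/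
abbrev ModeIndex (K : ℕ) : Type := Fin (2 * K + 1) ⊕ Fin (2 * K + 1)

/-- The wave mode of an index: `P` in the first block, `S` in the second. -/
def ModeIndex.mode {K : ℕ} : ModeIndex K → WaveMode
  | .inl _ => .P
  | .inr _ => .S

/-- The order in `-K, …, K` of an index, in either block. -/
def ModeIndex.order {K : ℕ} : ModeIndex K → ℤ
  | .inl i => modeOrder K i
  | .inr i => modeOrder K i

/-- The `N` equidistributed angles `2πj/N`, `j = 1, …, N`. -/
def equiAngle (N : ℕ) (j : Fin N) : ℝ := 2 * π * ((j : ℝ) + 1) / N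

/-- The coefficient `a^β_m` of the cylindrical wave of order `m` in the multipolar expansion of the
plane wave of mode `β` with direction of incidence `(cos θ, sin θ)`. -/
def planeWaveCoeff (B : ElasticBackground) (β : WaveMode) (m : ℤ) (θ : ℝ) : ℂ :=
  -(Complex.I / ((B.ρ * B.c β ^ 2 * B.κ β : ℝ) : ℂ)) *
    Complex.exp (Complex.I * m * ((π / 2 - θ : ℝ) : ℂ))

/-- `d^β_m = i a^β_m / (4 ρ ω²)`. -/
def sourceCoeff (B : ElasticBackground) (β : WaveMode) (m : ℤ) (θ : ℝ) : ℂ :=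
  Complex.I / ((4 * B.ρ * B.ω ^ 2 : ℝ) : ℂ) * planeWaveCoeff B β m θ

/-- The matrix `X^β`, with entries `d^β_m(s)`; the `s`-th direction of incidence has
the angle `θ_s + δ`. -/
def sourceBlock (B : ElasticBackground) (K N : ℕ) (δ : ℝ) (β : WaveMode) :
    Matrix (Fin N) (Fin (2 * K + 1)) ℂ :=
  Matrix.of fun s m => sourceCoeff B β (modeOrder K m) (equiAngle N s + δ)

/-- The block diagonal matrix `X` with blocks `X^P` and `X^S`. -/
def sourceMatrix (B : ElasticBackground) (K N : ℕ) (δ : ℝ) :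
    Matrix (Fin N ⊕ Fin N) (ModeIndex K) ℂ :=
  Matrix.fromBlocks (sourceBlock B K N δ .P) 0 0 (sourceBlock B K N δ .S)

/-- The matrix with entries `conj (H^α_n(x_r)) · e_r`, where `x_r` is the `r`-th receiver, on the
circle of radius `R`, and `e_r` is a real direction. -/
def receiverBlock (B : ElasticBackground) (K N : ℕ) (R : ℝ) (α : WaveMode) (e : Fin N → Plane) :
    Matrix (Fin N) (Fin (2 * K + 1)) ℂ :=
  Matrix.of fun r n => ∑ j : Fin 2,
    star (cylindricalElasticWave B α (modeOrder K n) (polarPoint R (equiAngle N r)) j) *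
      ((e r j : ℝ) : ℂ)

/-- The block matrix `Y`, for the directions of reception `d_r` and `d_r^⊥`. -/
def receiverMatrix (B : ElasticBackground) (K N : ℕ) (R : ℝ) (d dperp : Fin N → Plane) :
    Matrix (Fin N ⊕ Fin N) (ModeIndex K) ℂ :=
  Matrix.fromBlocks (receiverBlock B K N R .P d) (receiverBlock B K N R .S d)
    (receiverBlock B K N R .P dperp) (receiverBlock B K N R .S dperp)

/-- The linear operator `M ↦ X M Y*`. -/
def conjOperator {a b c d : Type*} [Fintype b] [Fintype d]
    (X : Matrix a b ℂ) (Y : Matrix c d ℂ) : Matrix b d ℂ →ₗ[ℂ] Matrix a c ℂ where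
  toFun M := X * M * Y.conjTranspose
  map_add' M N := by rw [Matrix.mul_add, Matrix.add_mul]
  map_smul' z M := by simp

/-- The MSR operator `L(M) = X M Y*`. -/
def msrOperator (B : ElasticBackground) (K Ns Nr : ℕ) (δ : ℝ) (d dperp : Fin Nr → Plane) (R : ℝ) :
    Matrix (ModeIndex K) (ModeIndex K) ℂ →ₗ[ℂ] Matrix (Fin Ns ⊕ Fin Ns) (Fin Nr ⊕ Fin Nr) ℂ :=
  conjOperator (sourceMatrix B K Ns δ) (receiverMatrix B K Nr R d dperp)

/-- The asymptotic singular value with index `(p, q)`,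
`√(Ns Nr) κ_β |(H⁽¹⁾_n)'(κ_β R)| / (4 ρ² ω² c_α² κ_α)`, where `α` is the mode of `p`, and `β`
and `n` are the mode and the order of `q`. -/
def msrSigma (B : ElasticBackground) (K Ns Nr : ℕ) (R : ℝ) (p q : ModeIndex K) : ℝ :=
  √((Ns : ℝ) * Nr) * (B.κ q.mode * ‖deriv (hankel1 q.order) (B.κ q.mode * R)‖) /
    (4 * B.ρ ^ 2 * B.ω ^ 2 * B.c p.mode ^ 2 * B.κ p.mode)

/-! ### Singular value decompositions of operators between spaces of matrices -/

/-- The Frobenius inner product `⟨M, N⟩ = ∑ conj (M i j) N i j`. -/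
def frobeniusInner {a b : Type*} [Fintype a] [Fintype b] (M N : Matrix a b ℂ) : ℂ :=
  ∑ i, ∑ j, star (M i j) * N i j

/-- A singular value decomposition of an operator `T` between spaces of matrices with the
Frobenius inner product: singular values `σ i ≥ 0`, orthonormal left singular vectors `U i`, and an
orthonormal basis of the domain of right singular vectors `V i`, with `T (V i) = σ i • U i`, that
is, `T = ∑ i, σ i • ⟨V i, ·⟩ U i`. -/
structure IsSVD {ι a b c d : Type*} [DecidableEq ι] [Fintype a] [Fintype b] [Fintype c] [Fintype d]
    (T : Matrix a b ℂ →ₗ[ℂ] Matrix c d ℂ) (σ : ι → ℝ) (U : ι → Matrix c d ℂ)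
    (V : ι → Matrix a b ℂ) : Prop where
  nonneg : ∀ i, 0 ≤ σ i
  left_orthonormal : ∀ i j, frobeniusInner (U i) (U j) = if i = j then 1 else 0
  right_orthonormal : ∀ i j, frobeniusInner (V i) (V j) = if i = j then 1 else 0
  right_span : Submodule.span ℂ (Set.range V) = ⊤
  map_eq : ∀ i, T (V i) = (σ i : ℂ) • U i

end

/-! The operator `M ↦ X M Y*` is a tensor product: on matrices `e_p w*` its Gram form is an entry of
`X*X` times the form of `Y*Y` (`frobeniusInner_conjOperator_rankOneMatrix`). So everything reduces
to the two Gram matrices.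

`X*X` is exactly diagonal: two orders differ by at most `2K < Ns`, so sums of exponentials over the
equidistributed directions vanish for distinct orders (`sourceMatrix_gram`). For `Y*Y`, Parseval in
the orthonormal pair at each receiver removes the directions of reception, and the same discrete
orthogonality leaves only the coupling of the P and S modes of equal order (`receiverMatrix_gram`).
In polar coordinates one component of each wave is `κ H'(κR)`, of size `R^{-1/2}`, and the other
`(in/R) H(κR)`, of size `R^{-3/2}`; the curl exchanges their roles. Hence the diagonal of `Y*Y` is
`N κ²|H'|²` up to `O(R^{-2})`, and the P–S coupling, a sum of products of a large and a small
component, is `O(R^{-2})`.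

After multiplication by `R` the diagonal entries tend to `N κ · 2/π`. As `κ_P < κ_S`, the gap
between the two diagonal entries of each `2 × 2` block is of exact order `1/R`, so an explicit
rotation with parameter `O(R^{-2})/R^{-1} = O(R^{-1})` diagonalizes the block. This gives an exact
decomposition for large `R` (`exists_isSVD_conjOperator`). Coincidences among singular values of
different orders or of different row indices do no harm, because those couplings vanish exactly.

The analytic input is that `√x |H_n(x)|` and `√x |H_n'(x)|` both tend to `√(2/π)`. Schläfli's
integrals write `H_n` as an arc integral with phase `x sin θ` plus a damped tail of size `O(1/x)`.
Modulo `O(1/x)` the amplitude of the arc integral matters only through its value at the stationary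
point `π/2`, since a difference divisible by `cos θ` can be integrated by parts. It may therefore be
replaced by a multiple of `cos ((θ - π/2)/2)`, for which a substitution produces a Fresnel integral
exactly. -/

/-! ### Oscillatory integrals -/

/-- Integration by parts: the oscillatory integral of an amplitude vanishing where the derivative
of the phase does is of order `1 / x`. -/
theorem exists_norm_oscillatory_integral_le {a b : ℝ} {φ φ' : ℝ → ℝ} {h h' : ℝ → ℂ}
    (hφ : ∀ t ∈ Set.uIcc a b, HasDerivAt φ (φ' t) t) (hφ' : ContinuousOn φ' (Set.uIcc a b))
    (hh : ∀ t ∈ Set.uIcc a b, HasDerivAt h (h' t) t) (hh' : ContinuousOn h' (Set.uIcc a b)) :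
    ∃ C : ℝ, ∀ x : ℝ, 0 < x →
      ‖∫ t in a..b, h t * (Complex.exp (Complex.I * (x * φ t)) * φ' t)‖ ≤ C / x := by
  -- The constant collects the boundary terms and the total variation of the amplitude; the outer
  -- absolute value allows `b < a`.
  refine ⟨‖h b‖ + ‖h a‖ + |∫ t in a..b, ‖h' t‖|, fun x hx => ?_⟩
  have hxc : (x : ℂ) ≠ 0 := by exact_mod_cast hx.ne'
  -- A primitive of the oscillating factor, of constant modulus `1 / x`; this is the whole gain.
  set v : ℝ → ℂ := fun t => Complex.exp (Complex.I * (x * φ t)) / (Complex.I * x) with hv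
  have hvn : ∀ t, ‖v t‖ = 1 / x := by
    intro t
    have h1 : Complex.I * (x * φ t) = ((x * φ t : ℝ) : ℂ) * Complex.I := by push_cast; ring
    rw [hv]
    simp only [norm_div, norm_mul, Complex.norm_I, one_mul, Complex.norm_real]
    rw [h1, Complex.norm_exp_ofReal_mul_I, Real.norm_of_nonneg hx.le]
  have hφc : ContinuousOn φ (Set.uIcc a b) := fun t ht => (hφ t ht).continuousAt.continuousWithinAt
  have hvd : ∀ t ∈ Set.uIcc a b,
      HasDerivAt v (Complex.exp (Complex.I * (x * φ t)) * φ' t) t := by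
    intro t ht
    have h1 := ((((hφ t ht).ofReal_comp.const_mul (x : ℂ)).const_mul Complex.I).cexp).div_const
      (Complex.I * x)
    refine h1.congr_deriv ?_
    field_simp
  have hvc : ContinuousOn v (Set.uIcc a b) := fun t ht => (hvd t ht).continuousAt.continuousWithinAt
  have hv'c : ContinuousOn (fun t => Complex.exp (Complex.I * (x * φ t)) * φ' t)
      (Set.uIcc a b) := by fun_prop
  rw [intervalIntegral.integral_mul_deriv_eq_deriv_mul hh hvd hh'.intervalIntegrable
    hv'c.intervalIntegrable]
  have h3 : ‖∫ t in a..b, h' t * v t‖ ≤ |∫ t in a..b, ‖h' t‖| / x := by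
    refine (intervalIntegral.norm_integral_le_abs_integral_norm).trans (le_of_eq ?_)
    simp only [norm_mul, hvn]
    rw [intervalIntegral.integral_mul_const, abs_mul, abs_of_pos (by positivity : 0 < 1 / x)]
    ring
  calc _ ≤ ‖h b * v b‖ + ‖h a * v a‖ + ‖∫ t in a..b, h' t * v t‖ := by
        refine (norm_sub_le _ _).trans ?_
        gcongr
        exact norm_sub_le _ _
    _ ≤ ‖h b‖ * (1 / x) + ‖h a‖ * (1 / x) + |∫ t in a..b, ‖h' t‖| / x := by
        rw [norm_mul, norm_mul, hvn, hvn]; gcongr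
    _ = _ := by ring

/-! ### The Fresnel integral -/

/-- The Fresnel integral `∫₀ᵀ exp (-iu²) du`. -/
noncomputable def fresnelIntegral (T : ℝ) : ℂ :=
  ∫ u in (0 : ℝ)..T, Complex.exp (-(Complex.I * u ^ 2))

/-- An auxiliary integral, whose derivative is that of the square of the Fresnel integral. -/
noncomputable def fresnelAux (T : ℝ) : ℂ :=
  ∫ t in (0 : ℝ)..1, Complex.exp (-(Complex.I * (T ^ 2 * (1 + t ^ 2)))) * (1 / (1 + t ^ 2) : ℝ)

theorem hasDerivAt_fresnelIntegral (T : ℝ) :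
    HasDerivAt fresnelIntegral (Complex.exp (-(Complex.I * T ^ 2))) T := by
  have hc : Continuous fun u : ℝ => Complex.exp (-(Complex.I * u ^ 2)) := by fun_prop
  exact intervalIntegral.integral_hasDerivAt_right (hc.intervalIntegrable _ _)
    (hc.stronglyMeasurableAtFilter _ _) hc.continuousAt

theorem fresnelIntegral_eq_mul (T : ℝ) :
    fresnelIntegral T = T * ∫ t in (0 : ℝ)..1, Complex.exp (-(Complex.I * (T * t) ^ 2)) := by
  have h := intervalIntegral.smul_integral_comp_mul_left (a := 0) (b := 1)
    (fun u : ℝ => Complex.exp (-(Complex.I * u ^ 2))) T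
  simp only [mul_zero, mul_one] at h
  rw [fresnelIntegral, ← h, Complex.real_smul]
  push_cast
  rfl

theorem norm_exp_neg_I_mul (y : ℝ) : ‖Complex.exp (-(Complex.I * y))‖ = 1 := by
  have : -(Complex.I * y) = ((-y : ℝ) : ℂ) * Complex.I := by push_cast; ring
  rw [this, Complex.norm_exp_ofReal_mul_I]

/-- Differentiation under the integral cancels the denominator `1 + t²`; the exponential then
splits, and rescaling `u = T t` recovers the Fresnel integral. -/
theorem hasDerivAt_fresnelAux (T : ℝ) :
    HasDerivAt fresnelAux
      (-(2 * Complex.I) * (Complex.exp (-(Complex.I * T ^ 2)) * fresnelIntegral T)) T := by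
  have hne : ∀ t : ℝ, (1 + t ^ 2 : ℝ) ≠ 0 := fun t => by positivity
  have hw : Continuous fun t : ℝ => ((1 / (1 + t ^ 2) : ℝ) : ℂ) :=
    Complex.continuous_ofReal.comp (continuous_const.div (by fun_prop) hne)
  have key := intervalIntegral.hasDerivAt_integral_of_dominated_loc_of_deriv_le
    (μ := volume) (a := 0) (b := 1)
    (F := fun (T t : ℝ) => Complex.exp (-(Complex.I * (T ^ 2 * (1 + t ^ 2)))) *
      (1 / (1 + t ^ 2) : ℝ))
    (F' := fun (T t : ℝ) => Complex.exp (-(Complex.I * (T ^ 2 * (1 + t ^ 2)))) *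
      (-(2 * Complex.I * T)))
    (x₀ := T) (s := Metric.ball T 1) (bound := fun _ => 2 * (|T| + 1))
    (Metric.ball_mem_nhds _ one_pos)
    (Eventually.of_forall fun T => Continuous.aestronglyMeasurable (by fun_prop))
    (Continuous.intervalIntegrable (by fun_prop) _ _)
    (Continuous.aestronglyMeasurable (by fun_prop))
    (ae_of_all _ fun t _ y hy => by
      have h1 : (y : ℂ) ^ 2 * (1 + (t : ℂ) ^ 2) = ((y ^ 2 * (1 + t ^ 2) : ℝ) : ℂ) := by
        push_cast; ring
      rw [norm_mul, h1, norm_exp_neg_I_mul]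
      simp only [norm_neg, norm_mul, Complex.norm_I, Complex.norm_real, Complex.norm_ofNat,
        one_mul, mul_one, Real.norm_eq_abs]
      have h2 : |y| ≤ |T| + 1 := by
        have h3 : |y - T| < 1 := by simpa [Real.dist_eq] using hy
        have h4 := abs_add_le (y - T) T
        rw [sub_add_cancel] at h4
        linarith
      linarith)
    (by simp)
    (ae_of_all _ fun t _ y _ => by
      have h1 : HasDerivAt (fun z : ℝ => ((z ^ 2 : ℝ) : ℂ)) ((2 * y : ℝ) : ℂ) y := by
        simpa using (hasDerivAt_pow 2 y).ofReal_comp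
      have h2 := (((h1.mul_const (1 + (t : ℂ) ^ 2)).const_mul Complex.I).fun_neg.cexp).mul_const
        ((1 / (1 + t ^ 2) : ℝ) : ℂ)
      have hne' : (1 + (t : ℂ) ^ 2) ≠ 0 := by exact_mod_cast hne t
      simp only [Complex.ofReal_pow] at h2
      refine h2.congr_deriv ?_
      push_cast
      field_simp)
  refine key.2.congr_deriv ?_
  rw [fresnelIntegral_eq_mul, intervalIntegral.integral_mul_const]
  have h1 : ∀ t : ℝ, Complex.exp (-(Complex.I * ((T : ℂ) ^ 2 * (1 + (t : ℂ) ^ 2)))) =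
      Complex.exp (-(Complex.I * T ^ 2)) * Complex.exp (-(Complex.I * (T * t) ^ 2)) := by
    intro t
    rw [← Complex.exp_add]; ring_nf
  simp only [h1]
  rw [intervalIntegral.integral_const_mul]
  ring

/-- The oscillatory version of the Gaussian integral trick: both sides have the same derivative, and
at `0` the auxiliary integral is `arctan 1 = π/4`. -/
theorem fresnelIntegral_sq (T : ℝ) :
    fresnelIntegral T ^ 2 = Complex.I * (fresnelAux T - (π / 4 : ℝ)) := by
  have hd : ∀ T, HasDerivAt (fun T => fresnelIntegral T ^ 2 - Complex.I * fresnelAux T) 0 T := by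
    intro T
    refine (((hasDerivAt_fresnelIntegral T).pow 2).sub
      ((hasDerivAt_fresnelAux T).const_mul Complex.I)).congr_deriv ?_
    linear_combination (2 * Complex.exp (-(Complex.I * T ^ 2)) * fresnelIntegral T) *
      Complex.I_mul_I
  have hc := is_const_of_deriv_eq_zero (fun T => (hd T).differentiableAt) (fun T => (hd T).deriv)
    T 0
  have h0 : fresnelIntegral 0 = 0 := by simp [fresnelIntegral]
  have h1 : fresnelAux 0 = (π / 4 : ℝ) := by
    have : fresnelAux 0 = ∫ t in (0 : ℝ)..1, ((1 / (1 + t ^ 2) : ℝ) : ℂ) := by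
      simp [fresnelAux]
    rw [this, intervalIntegral.integral_ofReal, integral_one_div_one_add_sq]
    simp
  simp only [h0, h1] at hc
  linear_combination hc

/-- The phase `T² (1 + t²)` is stationary only at `t = 0`. The piece over `[0, η]` is at most `η`,
and on `[η, 1]` integration by parts gives `O(1 / T²)`. -/
theorem tendsto_fresnelAux : Tendsto fresnelAux atTop (𝓝 0) := by
  rw [Metric.tendsto_nhds]
  intro ε hε
  obtain ⟨η, hη0, hη1, hηε⟩ : ∃ η : ℝ, 0 < η ∧ η ≤ 1 ∧ η < ε / 2 :=
    ⟨min 1 (ε / 4), by positivity, min_le_left _ _, (min_le_right _ _).trans_lt (by linarith)⟩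
  have hne : ∀ t : ℝ, (1 + t ^ 2 : ℝ) ≠ 0 := fun t => by positivity
  have hpos : ∀ t ∈ Set.uIcc η 1, 0 < t := by
    intro t ht
    rw [Set.uIcc_of_le hη1] at ht
    exact hη0.trans_le ht.1
  -- The large parameter is `T²`, and the amplitude is `1 / (1 + t²)` divided by the derivative
  -- `-2t` of the phase, which is smooth away from `0`.
  obtain ⟨C, hC⟩ := exists_norm_oscillatory_integral_le (a := η) (b := 1)
    (φ := fun t => -(1 + t ^ 2)) (φ' := fun t => -(2 * t))
    (h := fun t => ((-(1 / (2 * t * (1 + t ^ 2))) : ℝ) : ℂ))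
    (h' := fun t => (((2 * 1 * (1 + t ^ 2) + 2 * t * (2 * t)) / (2 * t * (1 + t ^ 2)) ^ 2 : ℝ) : ℂ))
    (fun t _ => by
      simpa only [Nat.cast_ofNat, Nat.add_one_sub_one, pow_one] using
        ((hasDerivAt_pow 2 t).const_add 1).fun_neg) (by fun_prop)
    (fun t ht => by
      have h0 := hpos t ht
      have h1 : HasDerivAt (fun t : ℝ => 2 * t * (1 + t ^ 2))
          (2 * 1 * (1 + t ^ 2) + 2 * t * (2 * t)) t := by
        simpa using (((hasDerivAt_id t).const_mul 2).fun_mul ((hasDerivAt_pow 2 t).const_add 1))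
      have h2 := (h1.fun_inv (by positivity)).fun_neg.ofReal_comp
      simp only [one_div]
      refine h2.congr_deriv ?_
      push_cast; ring)
    (by
      refine Complex.continuous_ofReal.comp_continuousOn (ContinuousOn.div (by fun_prop)
        (by fun_prop) fun t ht => ?_)
      have h0 := hpos t ht
      positivity)
  have hw : Continuous fun t : ℝ => ((1 / (1 + t ^ 2) : ℝ) : ℂ) :=
    Complex.continuous_ofReal.comp (continuous_const.div (by fun_prop) hne)
  have hlim : Tendsto (fun T : ℝ => C / T ^ 2) atTop (𝓝 0) :=
    tendsto_const_nhds.div_atTop (tendsto_pow_atTop two_ne_zero)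
  filter_upwards [hlim.eventually (gt_mem_nhds (half_pos hε)), eventually_gt_atTop 0] with T hT hT0
  have hcont : Continuous fun t : ℝ => Complex.exp (-(Complex.I * ((T : ℂ) ^ 2 *
      (1 + (t : ℂ) ^ 2)))) * (1 / (1 + t ^ 2) : ℝ) := by fun_prop
  rw [dist_zero_right, fresnelAux, ← intervalIntegral.integral_add_adjacent_intervals
    (hcont.intervalIntegrable 0 η) (hcont.intervalIntegrable η 1)]
  have h1 : ‖∫ t in (0 : ℝ)..η, Complex.exp (-(Complex.I * ((T : ℂ) ^ 2 *
      (1 + (t : ℂ) ^ 2)))) * (1 / (1 + t ^ 2) : ℝ)‖ ≤ 1 * |η - 0| := by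
    refine intervalIntegral.norm_integral_le_of_norm_le_const fun t _ => ?_
    have h1 : (T : ℂ) ^ 2 * (1 + (t : ℂ) ^ 2) = ((T ^ 2 * (1 + t ^ 2) : ℝ) : ℂ) := by
      push_cast; ring
    rw [norm_mul, h1, norm_exp_neg_I_mul, one_mul, Complex.norm_real, Real.norm_of_nonneg
      (by positivity), div_le_one (by positivity)]
    nlinarith [sq_nonneg t]
  have h2 := hC (T ^ 2) (by positivity)
  have h3 : (∫ t in η..1, Complex.exp (-(Complex.I * ((T : ℂ) ^ 2 *
      (1 + (t : ℂ) ^ 2)))) * (1 / (1 + t ^ 2) : ℝ)) = ∫ t in η..1,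
      ((-(1 / (2 * t * (1 + t ^ 2))) : ℝ) : ℂ) * (Complex.exp (Complex.I *
        (((T ^ 2 : ℝ) : ℂ) * ((-(1 + t ^ 2) : ℝ) : ℂ))) * ((-(2 * t) : ℝ) : ℂ)) := by
    refine intervalIntegral.integral_congr fun t ht => ?_
    have h0 : (t : ℂ) ≠ 0 := by exact_mod_cast (hpos t ht).ne'
    have h0' : (1 + (t : ℂ) ^ 2) ≠ 0 := by exact_mod_cast hne t
    push_cast
    rw [show Complex.I * ((T : ℂ) ^ 2 * -(1 + (t : ℂ) ^ 2)) =
      -(Complex.I * ((T : ℂ) ^ 2 * (1 + (t : ℂ) ^ 2))) by ring]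
    field_simp
  rw [← h3] at h2
  rw [sub_zero, abs_of_pos hη0, one_mul] at h1
  calc _ ≤ _ := norm_add_le _ _
    _ < ε := by linarith

/-- The value `√π / 2` of the modulus of the improper Fresnel integral. -/
theorem tendsto_norm_fresnelIntegral : Tendsto (fun T => ‖fresnelIntegral T‖) atTop (𝓝 (√π / 2))
    := by
  have h1 : Tendsto (fun T => ‖fresnelIntegral T ^ 2‖) atTop (𝓝 (π / 4)) := by
    have h2 := ((tendsto_fresnelAux.sub_const ((π / 4 : ℝ) : ℂ)).const_mul Complex.I).norm
    simp only [fresnelIntegral_sq]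
    convert h2 using 2
    rw [zero_sub, norm_mul, norm_neg, Complex.norm_I, one_mul, Complex.norm_real,
      Real.norm_of_nonneg (by positivity)]
  have h2 := h1.sqrt
  simp only [norm_pow, Real.sqrt_sq (norm_nonneg _)] at h2
  convert h2 using 2
  rw [Real.sqrt_div pi_pos.le, show (4 : ℝ) = 2 ^ 2 by norm_num, Real.sqrt_sq (by norm_num)]

/-! ### The integrals over an arc in the representation of the Hankel functions -/

/-- The integral `∫₀^π exp (i (x sin θ - nθ)) dθ`. -/
noncomputable def besselArc (n : ℤ) (x : ℝ) : ℂ :=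
  ∫ θ in (0 : ℝ)..π, Complex.exp (Complex.I * (x * Real.sin θ)) * Complex.exp (-(Complex.I * n * θ))

/-- An error `O(1/x)` is invisible at the scale `x^{-1/2}` of the leading term, so all reductions
below may be made modulo `O(1/x)`. -/
theorem tendsto_sqrt_mul_norm_of_sub_isBigO {f g : ℝ → ℂ} {L : ℝ}
    (hfg : (fun x => f x - g x) =O[atTop] fun x : ℝ => x⁻¹)
    (hg : Tendsto (fun x => √x * ‖g x‖) atTop (𝓝 L)) :
    Tendsto (fun x => √x * ‖f x‖) atTop (𝓝 L) := by
  have h0 : Tendsto (fun x : ℝ => √x * ‖x⁻¹‖) atTop (𝓝 0) := by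
    have h1 : Tendsto (fun x : ℝ => (√x)⁻¹) atTop (𝓝 0) :=
      tendsto_inv_atTop_zero.comp tendsto_sqrt_atTop
    refine h1.congr' ?_
    filter_upwards [eventually_gt_atTop 0] with x hx
    rw [Real.norm_of_nonneg (by positivity)]
    have := Real.sq_sqrt hx.le
    have h2 : √x ≠ 0 := by positivity
    field_simp
    linarith
  obtain ⟨C, hC⟩ := hfg.bound
  have h1 : Tendsto (fun x => √x * ‖f x‖ - √x * ‖g x‖) atTop (𝓝 0) := by
    refine squeeze_zero_norm' (a := fun x : ℝ => C * (√x * ‖x⁻¹‖)) ?_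
        (by simpa using h0.const_mul C)
    filter_upwards [hC] with x hx
    rw [← mul_sub, norm_mul, Real.norm_of_nonneg (Real.sqrt_nonneg x), Real.norm_eq_abs]
    calc √x * |‖f x‖ - ‖g x‖| ≤ √x * (C * ‖x⁻¹‖) := by
          gcongr
          exact (abs_norm_sub_norm_le _ _).trans hx
      _ = _ := by ring
  simpa using h1.add hg

theorem isBigO_inv_of_norm_le_div {f : ℝ → ℂ} {C : ℝ} (h : ∀ x : ℝ, 0 < x → ‖f x‖ ≤ C / x) :
    f =O[atTop] fun x : ℝ => x⁻¹ := by
  refine IsBigO.of_bound C ?_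
  filter_upwards [eventually_gt_atTop 0] with x hx
  rw [Real.norm_of_nonneg (by positivity), ← div_eq_mul_inv]
  exact h x hx

/-- An amplitude divisible by `cos θ`, the derivative of the phase `sin θ`. -/
theorem isBigO_integral_cos_mul {h h' : ℝ → ℂ}
    (hh : ∀ t ∈ Set.Icc 0 π, HasDerivAt h (h' t) t) (hh' : ContinuousOn h' (Set.Icc 0 π)) :
    (fun x : ℝ => ∫ θ in (0 : ℝ)..π, h θ * (Complex.exp (Complex.I * (x * Real.sin θ)) *
      Real.cos θ)) =O[atTop] fun x : ℝ => x⁻¹ := by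
  have hI : Set.uIcc 0 π = Set.Icc 0 π := Set.uIcc_of_le pi_pos.le
  obtain ⟨C, hC⟩ := exists_norm_oscillatory_integral_le (a := 0) (b := π) (φ := Real.sin)
    (φ' := Real.cos) (fun t _ => Real.hasDerivAt_sin t) Real.continuous_cos.continuousOn
    (hI ▸ hh) (hI ▸ hh')
  exact isBigO_inv_of_norm_le_div hC

theorem intervalIntegrable_besselArc (n : ℤ) (x a b : ℝ) :
    IntervalIntegrable (fun θ : ℝ => Complex.exp (Complex.I * (x * Real.sin θ)) *
      Complex.exp (-(Complex.I * n * θ))) volume a b :=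
  Continuous.intervalIntegrable (by fun_prop) _ _

theorem exp_int_mul_succ (n : ℤ) (θ : ℝ) :
    Complex.exp (-(Complex.I * (n + 1 : ℤ) * θ)) =
      Complex.exp (-(Complex.I * n * θ)) * (Real.cos θ - Real.sin θ * Complex.I) := by
  have h : -(Complex.I * (n + 1 : ℤ) * θ) = -(Complex.I * n * θ) + ((-θ : ℝ) : ℂ) * Complex.I := by
    push_cast; ring
  rw [h, Complex.exp_add, Complex.exp_mul_I, ← Complex.ofReal_cos, ← Complex.ofReal_sin,
    Real.cos_neg, Real.sin_neg]
  push_cast; ring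

theorem exp_int_mul_pred (n : ℤ) (θ : ℝ) :
    Complex.exp (-(Complex.I * (n - 1 : ℤ) * θ)) =
      Complex.exp (-(Complex.I * n * θ)) * (Real.cos θ + Real.sin θ * Complex.I) := by
  have h : -(Complex.I * (n - 1 : ℤ) * θ) = -(Complex.I * n * θ) + (θ : ℂ) * Complex.I := by
    push_cast; ring
  rw [h, Complex.exp_add, Complex.exp_mul_I, ← Complex.ofReal_cos, ← Complex.ofReal_sin]

/-- The two amplitudes add up to `2 cos θ · exp (-inθ)`, divisible by the derivative of the phase.
-/
theorem besselArc_succ_add_pred_isBigO (n : ℤ) :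
    (fun x => besselArc (n + 1) x + besselArc (n - 1) x) =O[atTop] fun x : ℝ => x⁻¹ := by
  have h := isBigO_integral_cos_mul
    (h := fun θ : ℝ => 2 * Complex.exp (-(Complex.I * n * θ)))
    (h' := fun θ : ℝ => 2 * (Complex.exp (-(Complex.I * n * θ)) * -(Complex.I * n * 1)))
    (fun θ _ => ((((Complex.ofRealCLM.hasDerivAt (x := θ)).const_mul
      (Complex.I * n)).fun_neg.cexp).const_mul 2)) (by fun_prop)
  refine h.congr_left fun x => ?_
  rw [besselArc, besselArc, ← intervalIntegral.integral_add (intervalIntegrable_besselArc _ _ _ _)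
    (intervalIntegrable_besselArc _ _ _ _)]
  congr 1 with θ
  rw [exp_int_mul_succ, exp_int_mul_pred]
  ring

/-- The amplitude `exp (-iθ) + i = cos θ + i (1 - sin θ)` vanishes at `π/2`. As `1 - sin θ = cos² θ
/ (1 + sin θ)`, its quotient by `cos θ` is smooth on `[0, π]`, where `sin θ ≥ 0`. -/
theorem besselArc_one_add_isBigO :
    (fun x => besselArc 1 x + Complex.I * besselArc 0 x) =O[atTop] fun x : ℝ => x⁻¹ := by
  have hs : ∀ θ ∈ Set.Icc 0 π, 1 + Real.sin θ ≠ 0 := fun θ hθ => by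
    have := Real.sin_nonneg_of_mem_Icc hθ
    positivity
  have h := isBigO_integral_cos_mul
    (h := fun θ : ℝ => 1 + Complex.I * ((Real.cos θ / (1 + Real.sin θ) : ℝ) : ℂ))
    (h' := fun θ : ℝ => Complex.I * (((-Real.sin θ * (1 + Real.sin θ) - Real.cos θ * Real.cos θ) /
      (1 + Real.sin θ) ^ 2 : ℝ) : ℂ))
    (fun θ hθ => ((((Real.hasDerivAt_cos θ).fun_div ((Real.hasDerivAt_sin θ).const_add 1)
      (hs θ hθ)).ofReal_comp).const_mul Complex.I).const_add 1)
    (continuousOn_const.mul (Complex.continuous_ofReal.comp_continuousOn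
      (ContinuousOn.div (by fun_prop) (by fun_prop) fun θ hθ => pow_ne_zero 2 (hs θ hθ))))
  refine h.congr_left fun x => ?_
  rw [besselArc, besselArc, ← intervalIntegral.integral_const_mul, ← intervalIntegral.integral_add
    (intervalIntegrable_besselArc _ _ _ _) ((intervalIntegrable_besselArc _ _ _ _).const_mul _)]
  refine intervalIntegral.integral_congr fun θ hθ => ?_
  rw [Set.uIcc_of_le pi_pos.le] at hθ
  have h0 : (1 + (Real.sin θ : ℂ)) ≠ 0 := by exact_mod_cast hs θ hθ
  have h1 := exp_int_mul_succ 0 θ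
  have h2 : (Real.sin θ : ℂ) ^ 2 + (Real.cos θ : ℂ) ^ 2 = 1 := by
    exact_mod_cast Real.sin_sq_add_cos_sq θ
  have h3 : (Real.cos θ : ℂ) / (1 + Real.sin θ) * Real.cos θ = 1 - Real.sin θ := by
    rw [div_mul_eq_mul_div, div_eq_iff h0]
    linear_combination h2
  have h4 : Complex.exp (-(Complex.I * (0 : ℤ) * θ)) = 1 := by simp
  rw [zero_add, h4, one_mul] at h1
  rw [h1, h4, Complex.ofReal_div, Complex.ofReal_add, Complex.ofReal_one]
  linear_combination (Complex.I * Complex.exp (Complex.I * (x * Real.sin θ))) * h3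

/-- The factor `(-i)^n` is the value of `exp (-inθ)` at the stationary point `π/2`. The recurrence
links orders two apart, so the induction, upwards and downwards, carries a pair of consecutive
orders and starts from orders `0` and `1`. -/
theorem besselArc_sub_isBigO (n : ℤ) :
    (fun x => besselArc n x - (-Complex.I) ^ n * besselArc 0 x) =O[atTop] fun x : ℝ => x⁻¹ := by
  have hI : (-Complex.I) ≠ 0 := neg_ne_zero.2 Complex.I_ne_zero
  have hI2 : (-Complex.I) ^ (2 : ℤ) = -1 := by
    rw [zpow_ofNat, neg_sq, Complex.I_sq]
  have hstep : ∀ m : ℤ, (-Complex.I) ^ (m + 1) = -(-Complex.I) ^ (m - 1) := fun m => by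
    rw [show m + 1 = m - 1 + 2 by ring, zpow_add₀ hI, hI2]
    ring
  have h0 : (fun x => besselArc 0 x - (-Complex.I) ^ (0 : ℤ) * besselArc 0 x)
      =O[atTop] fun x : ℝ => x⁻¹ := by
    simpa using isBigO_zero _ _
  have h1 : (fun x => besselArc 1 x - (-Complex.I) ^ (1 : ℤ) * besselArc 0 x)
      =O[atTop] fun x : ℝ => x⁻¹ := by
    refine besselArc_one_add_isBigO.congr_left fun x => ?_
    rw [zpow_one]; ring
  have hup : ∀ m : ℤ, (fun x => besselArc (m - 1) x - (-Complex.I) ^ (m - 1) * besselArc 0 x)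
      =O[atTop] (fun x : ℝ => x⁻¹) →
      (fun x => besselArc (m + 1) x - (-Complex.I) ^ (m + 1) * besselArc 0 x)
      =O[atTop] (fun x : ℝ => x⁻¹) := fun m hm => by
    refine ((besselArc_succ_add_pred_isBigO m).sub hm).congr_left fun x => ?_
    rw [hstep]; ring
  have hdown : ∀ m : ℤ, (fun x => besselArc (m + 1) x - (-Complex.I) ^ (m + 1) * besselArc 0 x)
      =O[atTop] (fun x : ℝ => x⁻¹) →
      (fun x => besselArc (m - 1) x - (-Complex.I) ^ (m - 1) * besselArc 0 x)
      =O[atTop] (fun x : ℝ => x⁻¹) := fun m hm => by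
    refine ((besselArc_succ_add_pred_isBigO m).sub hm).congr_left fun x => ?_
    rw [hstep]; ring
  have key : ∀ m : ℤ, (fun x => besselArc m x - (-Complex.I) ^ m * besselArc 0 x)
      =O[atTop] (fun x : ℝ => x⁻¹) ∧
      (fun x => besselArc (m + 1) x - (-Complex.I) ^ (m + 1) * besselArc 0 x)
      =O[atTop] (fun x : ℝ => x⁻¹) := fun m => by
    induction m using Int.induction_on with
    | zero => exact ⟨h0, by simpa only [zero_add] using h1⟩
    | succ i ih =>
      refine ⟨ih.2, hup _ ?_⟩
      simpa only [add_sub_cancel_right] using ih.1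
    | pred i ih =>
      refine ⟨hdown _ ih.2, ?_⟩
      simpa only [sub_add_cancel] using ih.1
  exact (key n).1

/-- Differentiating the phase brings down `i sin θ`, half the difference of `exp (iθ)` and `exp
(-iθ)`, which shifts the order by one. -/
theorem hasDerivAt_besselArc (n : ℤ) (x : ℝ) :
    HasDerivAt (besselArc n) ((besselArc (n - 1) x - besselArc (n + 1) x) / 2) x := by
  have key := intervalIntegral.hasDerivAt_integral_of_dominated_loc_of_deriv_le
    (μ := volume) (a := 0) (b := π)
    (F := fun (x θ : ℝ) => Complex.exp (Complex.I * (x * Real.sin θ)) *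
      Complex.exp (-(Complex.I * n * θ)))
    (F' := fun (x θ : ℝ) => Complex.exp (Complex.I * (x * Real.sin θ)) *
      (Complex.I * (1 * Real.sin θ)) * Complex.exp (-(Complex.I * n * θ)))
    (x₀ := x) (s := Set.univ) (bound := fun _ => 1) univ_mem
    (Eventually.of_forall fun T => Continuous.aestronglyMeasurable (by fun_prop))
    (intervalIntegrable_besselArc _ _ _ _)
    (Continuous.aestronglyMeasurable (by fun_prop))
    (ae_of_all _ fun θ _ y _ => by
      have h1 : -(Complex.I * n * θ) = -(Complex.I * ((n * θ : ℝ) : ℂ)) := by push_cast; ring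
      have h2 : Complex.I * (y * Real.sin θ) = -(Complex.I * ((-(y * Real.sin θ) : ℝ) : ℂ)) := by
        push_cast; ring
      rw [norm_mul, norm_mul, h1, h2, norm_exp_neg_I_mul, norm_exp_neg_I_mul]
      rw [one_mul, one_mul, mul_one, norm_mul, Complex.norm_I, one_mul, Complex.norm_real]
      exact Real.abs_sin_le_one θ)
    (by simp)
    (ae_of_all _ fun θ _ y _ =>
      ((((Complex.ofRealCLM.hasDerivAt (x := y)).mul_const
        (Real.sin θ : ℂ)).const_mul Complex.I).cexp).mul_const _)
  refine key.2.congr_deriv ?_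
  rw [besselArc, besselArc, ← intervalIntegral.integral_sub (intervalIntegrable_besselArc _ _ _ _)
    (intervalIntegrable_besselArc _ _ _ _), ← intervalIntegral.integral_div]
  congr 1 with θ
  rw [exp_int_mul_succ, exp_int_mul_pred]
  ring

/-- The zeroth arc integral with the amplitude `cos ((θ - π/2) / 2)`, which reduces to a Fresnel
integral. -/
theorem integral_cos_half_mul_exp {x : ℝ} (hx : 0 < x) :
    ∫ θ in (0 : ℝ)..π, Complex.exp (Complex.I * (x * Real.sin θ)) * Real.cos ((θ - π / 2) / 2) =
      2 / √(2 * x) * (Complex.exp (Complex.I * x) * (2 * fresnelIntegral √x)) := by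
  have h2x : 0 < √(2 * x) := Real.sqrt_pos.2 (by positivity)
  have hodd : fresnelIntegral (-√x) = -fresnelIntegral √x := by
    rw [fresnelIntegral_eq_mul, fresnelIntegral_eq_mul]
    push_cast
    simp
  have hmul : √(2 * x) * (√2 / 2) = √x := by
    rw [Real.sqrt_mul (by norm_num)]
    linear_combination (√x / 2) * Real.mul_self_sqrt (show (0 : ℝ) ≤ 2 by norm_num)
  -- With `u = √(2x) sin ((θ - π/2)/2)` the identity `sin θ = 1 - 2 sin² ((θ - π/2)/2)` gives `x sin
  -- θ = x - u²`. The half-angle cosine is, up to a constant, `du/dθ`, and the endpoints become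
  -- `∓√x`.
  set f : ℝ → ℝ := fun θ => √(2 * x) * Real.sin ((θ - π / 2) / 2) with hf
  have hfd : ∀ θ, HasDerivAt f (√(2 * x) * (Real.cos ((θ - π / 2) / 2) * (1 / 2))) θ := fun θ =>
    ((((hasDerivAt_id θ).sub_const (π / 2)).div_const 2).sin).const_mul _
  have hcv := intervalIntegral.integral_deriv_smul_comp (a := 0) (b := π) (f := f)
    (g := fun u : ℝ => Complex.exp (-(Complex.I * u ^ 2))) (fun θ _ => hfd θ)
    (by fun_prop) (by fun_prop)
  have hf0 : f 0 = -√x := by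
    rw [hf]
    beta_reduce
    rw [show (0 - π / 2) / 2 = -(π / 4) by ring, Real.sin_neg, Real.sin_pi_div_four]
    linarith
  have hf1 : f π = √x := by
    rw [hf]
    beta_reduce
    rw [show (π - π / 2) / 2 = π / 4 by ring, Real.sin_pi_div_four]
    exact hmul
  rw [hf0, hf1] at hcv
  have hint : ∀ a b : ℝ, IntervalIntegrable (fun u : ℝ => Complex.exp (-(Complex.I * u ^ 2)))
    volume a b := fun a b => Continuous.intervalIntegrable (by fun_prop) _ _
  have hsplit := intervalIntegral.integral_interval_sub_left (hint 0 √x) (hint 0 (-√x))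
  change fresnelIntegral √x - fresnelIntegral (-√x) = _ at hsplit
  rw [← hsplit, hodd, sub_neg_eq_add, ← two_mul] at hcv
  rw [← hcv, ← intervalIntegral.integral_const_mul, ← intervalIntegral.integral_const_mul]
  congr 1 with θ
  have h3 : Real.sin θ = 1 - 2 * Real.sin ((θ - π / 2) / 2) ^ 2 := by
    have h4 := Real.cos_two_mul ((θ - π / 2) / 2)
    rw [mul_div_cancel₀ _ (two_ne_zero), Real.cos_sub_pi_div_two] at h4
    linarith [Real.sin_sq_add_cos_sq ((θ - π / 2) / 2)]
  have h5 : (f θ) ^ 2 = x - x * Real.sin θ := by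
    rw [hf, mul_pow, Real.sq_sqrt (by positivity), h3]
    ring
  have h6 : Complex.exp (Complex.I * (x * Real.sin θ)) =
      Complex.exp (Complex.I * x) * Complex.exp (-(Complex.I * (f θ : ℂ) ^ 2)) := by
    rw [← Complex.exp_add]
    congr 1
    rw [← Complex.ofReal_pow, h5]
    push_cast; ring
  have h7 : ((√(2 * x) : ℝ) : ℂ) ≠ 0 := by exact_mod_cast h2x.ne'
  rw [Function.comp_apply, Complex.real_smul, h6]
  push_cast
  field_simp

/-- With `ψ = θ - π/2`, the difference of amplitudes is `1 - cos (ψ/2) = 2 sin² (ψ/4)`, while `cos θ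
= -sin ψ = -4 sin (ψ/4) cos (ψ/4) cos (ψ/2)`. The quotient is smooth because `|ψ| ≤ π/2` keeps both
cosines positive. -/
theorem besselArc_zero_sub_isBigO :
    (fun x => besselArc 0 x - ∫ θ in (0 : ℝ)..π, Complex.exp (Complex.I * (x * Real.sin θ)) *
      Real.cos ((θ - π / 2) / 2)) =O[atTop] fun x : ℝ => x⁻¹ := by
  have hc4 : ∀ θ ∈ Set.Icc 0 π, 0 < Real.cos ((θ - π / 2) / 4) := fun θ hθ =>
    Real.cos_pos_of_mem_Ioo ⟨by linarith [hθ.1, pi_pos], by linarith [hθ.2, pi_pos]⟩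
  have hc2 : ∀ θ ∈ Set.Icc 0 π, 0 < Real.cos ((θ - π / 2) / 2) := fun θ hθ =>
    Real.cos_pos_of_mem_Ioo ⟨by linarith [hθ.1, pi_pos], by linarith [hθ.2, pi_pos]⟩
  have hne : ∀ θ ∈ Set.Icc 0 π,
      2 * (Real.cos ((θ - π / 2) / 4) * Real.cos ((θ - π / 2) / 2)) ≠ 0 := fun θ hθ =>
    (mul_pos two_pos (mul_pos (hc4 θ hθ) (hc2 θ hθ))).ne'
  have hid : ∀ (θ c : ℝ), HasDerivAt (fun θ => (θ - π / 2) / c) (1 / c) θ := fun θ c =>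
    ((hasDerivAt_id θ).sub_const (π / 2)).div_const c
  have h := isBigO_integral_cos_mul
    (fun θ hθ => ((((hid θ 4).sin.fun_neg).fun_div
      (((hid θ 4).cos.fun_mul (hid θ 2).cos).const_mul 2) (hne θ hθ)).ofReal_comp))
    (Complex.continuous_ofReal.comp_continuousOn
      (ContinuousOn.div (by fun_prop) (by fun_prop) fun θ hθ => pow_ne_zero 2 (hne θ hθ)))
  refine h.congr_left fun x => ?_
  rw [besselArc, ← intervalIntegral.integral_sub (intervalIntegrable_besselArc _ _ _ _)
    (Continuous.intervalIntegrable (by fun_prop) _ _)]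
  refine intervalIntegral.integral_congr fun θ hθ => ?_
  rw [Set.uIcc_of_le pi_pos.le] at hθ
  have h1 : Real.cos θ = -(4 * Real.sin ((θ - π / 2) / 4) * Real.cos ((θ - π / 2) / 4) *
      Real.cos ((θ - π / 2) / 2)) := by
    have h2 := Real.sin_two_mul ((θ - π / 2) / 2)
    have h3 := Real.sin_two_mul ((θ - π / 2) / 4)
    rw [mul_div_cancel₀ _ (two_ne_zero), Real.sin_sub_pi_div_two] at h2
    rw [show 2 * ((θ - π / 2) / 4) = (θ - π / 2) / 2 by ring] at h3
    rw [h3] at h2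
    linarith
  have h4 : Real.cos ((θ - π / 2) / 2) = 1 - 2 * Real.sin ((θ - π / 2) / 4) ^ 2 := by
    have h3 := Real.cos_two_mul ((θ - π / 2) / 4)
    rw [show 2 * ((θ - π / 2) / 4) = (θ - π / 2) / 2 by ring] at h3
    linarith [Real.sin_sq_add_cos_sq ((θ - π / 2) / 4)]
  have h5 : -Real.sin ((θ - π / 2) / 4) /
      (2 * (Real.cos ((θ - π / 2) / 4) * Real.cos ((θ - π / 2) / 2))) * Real.cos θ =
      1 - Real.cos ((θ - π / 2) / 2) := by
    rw [div_mul_eq_mul_div, div_eq_iff (hne θ hθ)]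
    have h6 : 1 - Real.cos ((θ - π / 2) / 2) = 2 * Real.sin ((θ - π / 2) / 4) ^ 2 := by linarith
    rw [h6, h1]
    ring
  have h7 := congrArg (fun r : ℝ => (r : ℂ)) h5
  beta_reduce at h7 ⊢
  rw [Complex.ofReal_mul, Complex.ofReal_sub, Complex.ofReal_one] at h7
  simp only [Int.cast_zero, mul_zero, zero_mul, neg_zero, Complex.exp_zero, mul_one]
  linear_combination Complex.exp (Complex.I * (x * Real.sin θ)) * h7

theorem tendsto_sqrt_mul_norm_besselArc (n : ℤ) :
    Tendsto (fun x => √x * ‖besselArc n x‖) atTop (𝓝 √(2 * π)) := by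
  have h0 : Tendsto (fun x => √x * ‖besselArc 0 x‖) atTop (𝓝 √(2 * π)) := by
    refine tendsto_sqrt_mul_norm_of_sub_isBigO besselArc_zero_sub_isBigO ?_
    have h1 := (tendsto_norm_fresnelIntegral.comp tendsto_sqrt_atTop).const_mul (2 * √2)
    have h2 : 2 * √2 * (√π / 2) = √(2 * π) := by
      rw [Real.sqrt_mul (by norm_num)]; ring
    rw [h2] at h1
    refine h1.congr' ?_
    filter_upwards [eventually_gt_atTop 0] with x hx
    have h3 : Complex.I * (x : ℂ) = (x : ℂ) * Complex.I := mul_comm _ _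
    rw [integral_cos_half_mul_exp hx, norm_mul, norm_mul, norm_mul, norm_div, h3,
      Complex.norm_exp_ofReal_mul_I, Complex.norm_real, Complex.norm_ofNat,
      Real.norm_of_nonneg (Real.sqrt_nonneg _), Real.sqrt_mul (by norm_num), Function.comp_apply]
    have h4 : √x ≠ 0 := by positivity
    have h5 : √2 ≠ 0 := by positivity
    field_simp
    rw [Real.sq_sqrt (by norm_num)]
  refine tendsto_sqrt_mul_norm_of_sub_isBigO (besselArc_sub_isBigO n) ?_
  simpa using h0

/-! ### The exponentially damped integral in the Hankel functions -/

/-- The second of Schläfli's integrals for `Y_n`. -/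
noncomputable def besselTail (n : ℤ) (x : ℝ) : ℝ :=
  ∫ t in Set.Ioi (0 : ℝ),
      (Real.exp (n * t) + (-1) ^ n * Real.exp (-(n * t))) * Real.exp (-(x * Real.sinh t))

/-- The inequality `t ≤ sinh t` replaces the double exponential decay by a simple exponential, which
is enough for large `x`. -/
theorem norm_mul_exp_neg_sinh_le {g : ℝ → ℝ} {M a x t : ℝ} (hx : 0 ≤ x) (ht : 0 < t)
    (hg : |g t| ≤ M * Real.exp (a * t)) :
    ‖g t * Real.exp (-(x * Real.sinh t))‖ ≤ M * Real.exp (-(x - a) * t) := by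
  rw [norm_mul, Real.norm_eq_abs, Real.norm_eq_abs, Real.abs_exp]
  calc |g t| * Real.exp (-(x * Real.sinh t)) ≤ M * Real.exp (a * t) * Real.exp (-(x * t)) := by
        have h1 : t ≤ Real.sinh t := Real.self_le_sinh_iff.2 ht.le
        gcongr
        exact (abs_nonneg _).trans hg
    _ = M * Real.exp (-(x - a) * t) := by
        rw [mul_assoc, ← Real.exp_add]; ring_nf

theorem integrableOn_const_mul_exp {M b : ℝ} (hb : 0 < b) :
    IntegrableOn (fun t : ℝ => M * Real.exp (-b * t)) (Set.Ioi 0) :=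
  (integrableOn_exp_mul_Ioi (neg_neg_of_pos hb) 0).const_mul M

theorem integrableOn_mul_exp_neg_sinh {g : ℝ → ℝ} (hgc : Continuous g) {M a x : ℝ} (hx : 0 ≤ x)
    (hax : a < x) (hg : ∀ t, 0 < t → |g t| ≤ M * Real.exp (a * t)) :
    IntegrableOn (fun t => g t * Real.exp (-(x * Real.sinh t))) (Set.Ioi 0) := by
  have hsinh := Real.continuous_sinh
  refine (integrableOn_const_mul_exp (M := M) (sub_pos.2 hax)).mono'
    (Continuous.aestronglyMeasurable (by fun_prop)) ?_
  exact (ae_restrict_iff' measurableSet_Ioi).2 (ae_of_all _ fun t ht =>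
    norm_mul_exp_neg_sinh_le hx ht (hg t ht))

theorem norm_integral_mul_exp_neg_sinh_le {g : ℝ → ℝ} {M a x : ℝ} (hx : 0 ≤ x)
    (hax : a < x) (hg : ∀ t, 0 < t → |g t| ≤ M * Real.exp (a * t)) :
    ‖∫ t in Set.Ioi (0 : ℝ), g t * Real.exp (-(x * Real.sinh t))‖ ≤ M / (x - a) := by
  have h := norm_integral_le_of_norm_le (integrableOn_const_mul_exp (M := M) (sub_pos.2 hax))
    ((ae_restrict_iff' measurableSet_Ioi).2 (ae_of_all _ fun t ht =>
      norm_mul_exp_neg_sinh_le hx ht (hg t ht)))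
  rw [integral_const_mul, integral_exp_mul_Ioi (by linarith)] at h
  refine h.trans (le_of_eq ?_)
  rw [mul_zero, Real.exp_zero, neg_div_neg_eq, mul_one_div]

theorem integral_mul_exp_neg_sinh_isBigO {g : ℝ → ℝ} {M a : ℝ}
    (hg : ∀ t, 0 < t → |g t| ≤ M * Real.exp (a * t)) :
    (fun x : ℝ => ∫ t in Set.Ioi (0 : ℝ), g t * Real.exp (-(x * Real.sinh t)))
      =O[atTop] fun x : ℝ => x⁻¹ := by
  have hM : 0 ≤ M := by
    have h1 := (abs_nonneg _).trans (hg 1 one_pos)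
    exact nonneg_of_mul_nonneg_left h1 (Real.exp_pos _)
  refine IsBigO.of_bound (2 * M) ?_
  filter_upwards [eventually_gt_atTop 0, eventually_gt_atTop (2 * |a|)] with x hx hxa
  have ha := le_abs_self a
  have hxa' : x / 2 ≤ x - a := by linarith
  refine (norm_integral_mul_exp_neg_sinh_le hx.le (by linarith) hg).trans ?_
  rw [Real.norm_of_nonneg (by positivity), ← div_eq_mul_inv, mul_comm 2 M]
  calc M / (x - a) ≤ M / (x / 2) := by gcongr
    _ = M * 2 / x := by field_simp

theorem abs_exp_add_exp_le (n : ℤ) {t : ℝ} (ht : 0 < t) :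
    |Real.exp (n * t) + (-1) ^ n * Real.exp (-(n * t))| ≤ 2 * Real.exp (|(n : ℝ)| * t) := by
  have h1 : Real.exp (n * t) ≤ Real.exp (|(n : ℝ)| * t) := by
    gcongr; exact le_abs_self _
  have h2 : Real.exp (-(n * t)) ≤ Real.exp (|(n : ℝ)| * t) := by
    rw [← neg_mul]; gcongr; exact neg_le_abs _
  refine (abs_add_le _ _).trans ?_
  rw [abs_mul, abs_neg_one_zpow, one_mul, Real.abs_exp, Real.abs_exp]
  linarith

theorem abs_exp_add_exp_mul_sinh_le (n : ℤ) {t : ℝ} (ht : 0 < t) :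
    |(Real.exp (n * t) + (-1) ^ n * Real.exp (-(n * t))) * -Real.sinh t| ≤
      2 * Real.exp ((|(n : ℝ)| + 1) * t) := by
  have h1 : |(-Real.sinh t)| ≤ Real.exp t := by
    rw [abs_neg, abs_of_pos (Real.sinh_pos_iff.2 ht), Real.sinh_eq]
    linarith [Real.exp_pos t, Real.exp_pos (-t)]
  rw [abs_mul, add_mul, one_mul, Real.exp_add, ← mul_assoc]
  gcongr
  exact abs_exp_add_exp_le n ht

/-- The differentiated integrand grows at most like `exp ((|n| + 1) t)` before damping, so for
arguments beyond `|n| + 2` it is dominated by `2 exp (-t)`. Only large arguments are ever needed. -/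
theorem hasDerivAt_besselTail (n : ℤ) {x : ℝ} (hx : |(n : ℝ)| + 2 < x) :
    HasDerivAt (besselTail n) (∫ t in Set.Ioi (0 : ℝ),
      (Real.exp (n * t) + (-1) ^ n * Real.exp (-(n * t))) * -Real.sinh t *
        Real.exp (-(x * Real.sinh t))) x := by
  have hsinh := Real.continuous_sinh
  have habs := abs_nonneg (n : ℝ)
  refine (hasDerivAt_integral_of_dominated_loc_of_deriv_le (μ := volume.restrict (Set.Ioi (0 : ℝ)))
    (F := fun x t => (Real.exp (n * t) + (-1) ^ n * Real.exp (-(n * t))) *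
      Real.exp (-(x * Real.sinh t)))
    (F' := fun x t => (Real.exp (n * t) + (-1) ^ n * Real.exp (-(n * t))) * -Real.sinh t *
        Real.exp (-(x * Real.sinh t)))
    (x₀ := x) (s := Set.Ioi (|(n : ℝ)| + 2)) (bound := fun t => 2 * Real.exp (-1 * t))
    (Ioi_mem_nhds hx)
    (Eventually.of_forall fun y => Continuous.aestronglyMeasurable (by fun_prop))
    (integrableOn_mul_exp_neg_sinh (by fun_prop) (by linarith) (by linarith)
      fun t => abs_exp_add_exp_le n)
    (Continuous.aestronglyMeasurable (by fun_prop))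
    ((ae_restrict_iff' measurableSet_Ioi).2 (ae_of_all _ fun t ht y hy => ?_))
    (integrableOn_const_mul_exp one_pos)
    (ae_of_all _ fun t y _ => ?_)).2
  · have ht' : (0 : ℝ) < t := ht
    have hy' : |(n : ℝ)| + 2 < y := hy
    refine (norm_mul_exp_neg_sinh_le (g := fun t => (Real.exp (n * t) + (-1) ^ n *
      Real.exp (-(n * t))) * -Real.sinh t) (by linarith) ht
      (abs_exp_add_exp_mul_sinh_le n ht)).trans ?_
    gcongr
    linarith
  · have h1 := (((hasDerivAt_id y).mul_const (Real.sinh t)).fun_neg.exp).const_mul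
      (Real.exp (n * t) + (-1) ^ n * Real.exp (-(n * t)))
    refine h1.congr_deriv ?_
    simp only [id_eq]
    ring

theorem besselTail_isBigO (n : ℤ) : besselTail n =O[atTop] fun x : ℝ => x⁻¹ :=
  integral_mul_exp_neg_sinh_isBigO fun _ => abs_exp_add_exp_le n

theorem deriv_besselTail_isBigO (n : ℤ) : deriv (besselTail n) =O[atTop] fun x : ℝ => x⁻¹ := by
  refine (integral_mul_exp_neg_sinh_isBigO fun _ => abs_exp_add_exp_mul_sinh_le n).congr' ?_
    EventuallyEq.rfl
  filter_upwards [eventually_gt_atTop (|(n : ℝ)| + 2)] with x hx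
  exact (hasDerivAt_besselTail n hx).deriv.symm

/-! ### Large arguments of the Hankel functions -/

/-- The cosine integral of `J_n` and the sine integral of `Y_n` are the real and imaginary parts of
one arc integral; the rest of `Y_n` is the damped tail. -/
theorem hankel1_eq (n : ℤ) (x : ℝ) :
    hankel1 n x = (1 / π : ℝ) * (besselArc n x - Complex.I * (besselTail n x : ℝ)) := by
  have h1 : besselArc n x = ((∫ θ in (0 : ℝ)..π, Real.cos (x * Real.sin θ - n * θ) : ℝ) : ℂ) +
      Complex.I * ((∫ θ in (0 : ℝ)..π, Real.sin (x * Real.sin θ - n * θ) : ℝ) : ℂ) := by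
    rw [← intervalIntegral.integral_ofReal, ← intervalIntegral.integral_ofReal,
      ← intervalIntegral.integral_const_mul, ← intervalIntegral.integral_add
        (Continuous.intervalIntegrable (by fun_prop) _ _)
        (Continuous.intervalIntegrable (by fun_prop) _ _)]
    unfold besselArc
    congr 1 with θ
    rw [← Complex.exp_add, show Complex.I * (x * Real.sin θ) + -(Complex.I * n * θ) =
      ((x * Real.sin θ - n * θ : ℝ) : ℂ) * Complex.I by push_cast; ring, Complex.exp_mul_I,
      ← Complex.ofReal_cos, ← Complex.ofReal_sin]
    ring
  rw [h1, hankel1, besselJ, besselY, ← besselTail]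
  push_cast
  ring

theorem hasDerivAt_hankel1 (n : ℤ) {x : ℝ} (hx : |(n : ℝ)| + 2 < x) :
    HasDerivAt (hankel1 n) ((1 / π : ℝ) * ((besselArc (n - 1) x - besselArc (n + 1) x) / 2 -
      Complex.I * (deriv (besselTail n) x : ℝ))) x := by
  have h1 := (hasDerivAt_besselTail n hx).differentiableAt.hasDerivAt.ofReal_comp
  rw [funext (hankel1_eq n)]
  exact ((hasDerivAt_besselArc n x).sub (h1.const_mul Complex.I)).const_mul _

theorem eventually_differentiableAt_hankel1 (n : ℤ) :
    ∀ᶠ x in atTop, DifferentiableAt ℝ (hankel1 n) x := by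
  filter_upwards [eventually_gt_atTop (|(n : ℝ)| + 2)] with x hx
  exact (hasDerivAt_hankel1 n hx).differentiableAt

theorem tendsto_inv_pi_mul_sqrt_mul_norm_besselArc (n : ℤ) :
    Tendsto (fun x => √x * ‖((1 / π : ℝ) : ℂ) * besselArc n x‖) atTop (𝓝 √(2 / π)) := by
  have h := (tendsto_sqrt_mul_norm_besselArc n).const_mul (1 / π)
  have h1 : 1 / π * √(2 * π) = √(2 / π) := by
    rw [show 2 / π = 2 * π / π ^ 2 by field_simp, Real.sqrt_div (by positivity),
      Real.sqrt_sq pi_pos.le]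
    ring
  rw [h1] at h
  refine h.congr fun x => ?_
  rw [norm_mul, Complex.norm_real, Real.norm_of_nonneg (by positivity)]
  ring

theorem tendsto_sqrt_mul_norm_hankel1 (n : ℤ) :
    Tendsto (fun x => √x * ‖hankel1 n x‖) atTop (𝓝 √(2 / π)) := by
  refine tendsto_sqrt_mul_norm_of_sub_isBigO ?_ (tendsto_inv_pi_mul_sqrt_mul_norm_besselArc n)
  have h := ((Complex.isBigO_ofReal_left.2 (besselTail_isBigO n)).const_mul_left
    (-(((1 / π : ℝ) : ℂ) * Complex.I)))
  refine h.congr_left fun x => ?_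
  rw [hankel1_eq]
  ring

/-- Half the difference of the arc integrals of orders `n - 1` and `n + 1` equals the one of order
`n - 1` minus half their sum, and that sum is `O(1/x)`. -/
theorem tendsto_sqrt_mul_norm_deriv_hankel1 (n : ℤ) :
    Tendsto (fun x => √x * ‖deriv (hankel1 n) x‖) atTop (𝓝 √(2 / π)) := by
  refine tendsto_sqrt_mul_norm_of_sub_isBigO ?_
    (tendsto_inv_pi_mul_sqrt_mul_norm_besselArc (n - 1))
  have h1 := (Complex.isBigO_ofReal_left.2 (deriv_besselTail_isBigO n)).const_mul_left
    (-(((1 / π : ℝ) : ℂ) * Complex.I))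
  have h2 := (besselArc_succ_add_pred_isBigO n).const_mul_left (-((1 / π : ℝ) : ℂ) / 2)
  refine (h1.add h2).congr' ?_ EventuallyEq.rfl
  filter_upwards [eventually_gt_atTop (|(n : ℝ)| + 2)] with x hx
  rw [(hasDerivAt_hankel1 n hx).deriv]
  ring

theorem isBigO_of_tendsto_sqrt_mul_norm {f : ℝ → ℂ} {L : ℝ}
    (h : Tendsto (fun x => √x * ‖f x‖) atTop (𝓝 L)) :
    f =O[atTop] fun x : ℝ => (√x)⁻¹ := by
  have h1 := (h.isBigO_one ℝ).mul (isBigO_refl (fun x : ℝ => (√x)⁻¹) atTop)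
  refine IsBigO.of_norm_left ((h1.congr' ?_ (by simp)))
  filter_upwards [eventually_gt_atTop 0] with x hx
  have : √x ≠ 0 := by positivity
  field_simp

/-! ### Cylindrical waves in polar coordinates -/

/-- The radial unit vector at the angle `θ`. -/
noncomputable def radialUnit (θ : ℝ) : Plane := !₂[Real.cos θ, Real.sin θ]

/-- The tangential unit vector at the angle `θ`. -/
noncomputable def angularUnit (θ : ℝ) : Plane := !₂[-Real.sin θ, Real.cos θ]

theorem hasDerivAt_radialUnit (θ : ℝ) : HasDerivAt radialUnit (angularUnit θ) θ := by
  have h : HasDerivAt (fun θ => ![Real.cos θ, Real.sin θ]) ![-Real.sin θ, Real.cos θ] θ := by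
    rw [hasDerivAt_pi]
    intro i
    fin_cases i
    · exact Real.hasDerivAt_cos θ
    · exact Real.hasDerivAt_sin θ
  exact (PiLp.continuousLinearEquiv 2 ℝ
    fun _ : Fin 2 => ℝ).symm.toContinuousLinearMap.hasFDerivAt.comp_hasDerivAt θ h

theorem polarPoint_eq_smul (R θ : ℝ) : polarPoint R θ = R • radialUnit θ := by
  ext i
  fin_cases i <;> simp [polarPoint, radialUnit]

theorem norm_radialUnit (θ : ℝ) : ‖radialUnit θ‖ = 1 := by
  rw [EuclideanSpace.norm_eq]
  simp [radialUnit]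

theorem norm_polarPoint {R : ℝ} (hR : 0 ≤ R) (θ : ℝ) : ‖polarPoint R θ‖ = R := by
  rw [polarPoint_eq_smul, norm_smul, norm_radialUnit, mul_one, Real.norm_of_nonneg hR]

theorem norm_coord_eq (x : Plane) : ‖(x 0 : ℂ) + (x 1 : ℂ) * Complex.I‖ = ‖x‖ := by
  rw [Complex.norm_add_mul_I, EuclideanSpace.norm_eq]
  simp

/-- An integer power of `x / |x|` does not see the branch of the argument, so the wave is
differentiable across the cut too. -/
theorem exp_I_mul_polarAngle (n : ℤ) {x : Plane} (hx : x ≠ 0) :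
    Complex.exp (Complex.I * n * polarAngle x) =
      (((x 0 : ℂ) + (x 1 : ℂ) * Complex.I) / (‖x‖ : ℝ)) ^ n := by
  have h0 : ((‖x‖ : ℝ) : ℂ) ≠ 0 := by exact_mod_cast norm_ne_zero_iff.2 hx
  have h1 := Complex.norm_mul_exp_arg_mul_I ((x 0 : ℂ) + (x 1 : ℂ) * Complex.I)
  rw [norm_coord_eq] at h1
  rw [show Complex.I * n * polarAngle x = n * (polarAngle x * Complex.I) by ring,
    Complex.exp_int_mul, polarAngle, eq_div_of_mul_eq h0 ((mul_comm _ _).trans h1)]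

theorem cylindricalWave_polarPoint (n : ℤ) (κ : ℝ) {R : ℝ} (hR : 0 < R) (θ : ℝ) :
    cylindricalWave n κ (polarPoint R θ) =
      hankel1 n (κ * R) * Complex.exp (Complex.I * n * θ) := by
  have hx : polarPoint R θ ≠ 0 := by
    rw [← norm_ne_zero_iff, norm_polarPoint hR.le]; exact hR.ne'
  have hR' : (R : ℂ) ≠ 0 := by exact_mod_cast hR.ne'
  rw [cylindricalWave, exp_I_mul_polarAngle n hx, norm_polarPoint hR.le]
  congr 1
  rw [show Complex.I * n * θ = n * (θ * Complex.I) by ring, Complex.exp_int_mul,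
    Complex.exp_mul_I]
  congr 1
  rw [div_eq_iff hR']
  simp [polarPoint]
  ring

theorem differentiableAt_cylindricalWave (n : ℤ) (κ : ℝ) {x : Plane} (hx : x ≠ 0)
    (hH : DifferentiableAt ℝ (hankel1 n) (κ * ‖x‖)) :
    DifferentiableAt ℝ (cylindricalWave n κ) x := by
  have hnorm : DifferentiableAt ℝ (fun y : Plane => ‖y‖) x :=
    (contDiffAt_norm ℝ hx (n := 1)).differentiableAt one_ne_zero
  have h0 : ((‖x‖ : ℝ) : ℂ) ≠ 0 := by exact_mod_cast norm_ne_zero_iff.2 hx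
  have h1 : DifferentiableAt ℝ (fun y : Plane => hankel1 n (κ * ‖y‖)) x :=
    DifferentiableAt.comp x (f := fun y : Plane => κ * ‖y‖) hH (hnorm.const_mul κ)
  have hco : ∀ j : Fin 2, DifferentiableAt ℝ (fun y : Plane => ((y j : ℝ) : ℂ)) x := fun j =>
    (Complex.ofRealCLM.differentiableAt).comp x
      (EuclideanSpace.proj (𝕜 := ℝ) j).differentiableAt
  have h2 : DifferentiableAt ℝ (fun y : Plane =>
      ((y 0 : ℂ) + (y 1 : ℂ) * Complex.I) / ((‖y‖ : ℝ) : ℂ)) x := by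
    have h3 : DifferentiableAt ℝ (fun y : Plane => ((‖y‖ : ℝ) : ℂ)) x :=
      (Complex.ofRealCLM.differentiableAt).comp x hnorm
    exact ((hco 0).add ((hco 1).mul_const _)).mul (h3.inv h0)
  have hz : ((x 0 : ℂ) + (x 1 : ℂ) * Complex.I) / ((‖x‖ : ℝ) : ℂ) ≠ 0 := by
    refine div_ne_zero ?_ h0
    rw [← norm_ne_zero_iff, norm_coord_eq]
    exact norm_ne_zero_iff.2 hx
  have h4 : DifferentiableAt ℝ (fun y : Plane =>
      (((y 0 : ℂ) + (y 1 : ℂ) * Complex.I) / ((‖y‖ : ℝ) : ℂ)) ^ n) x :=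
    DifferentiableAt.comp x (g := fun z : ℂ => z ^ n)
      (((differentiableAt_zpow (𝕜 := ℂ) (m := n)).2 (Or.inl hz)).restrictScalars ℝ) h2
  refine (h1.mul h4).congr_of_eventuallyEq ?_
  filter_upwards [isOpen_ne.mem_nhds hx] with y hy
  rw [cylindricalWave, exp_I_mul_polarAngle n hy]
  rfl

section Partials

variable {n : ℤ} {κ R : ℝ}

theorem fderiv_cylindricalWave_radialUnit (hR : 0 < R) (θ : ℝ)
    (hH : DifferentiableAt ℝ (hankel1 n) (κ * R)) :
    fderiv ℝ (cylindricalWave n κ) (polarPoint R θ) (radialUnit θ) =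
      κ * deriv (hankel1 n) (κ * R) * Complex.exp (Complex.I * n * θ) := by
  have hx : polarPoint R θ ≠ 0 := by
    rw [← norm_ne_zero_iff, norm_polarPoint hR.le]; exact hR.ne'
  have hd := (differentiableAt_cylindricalWave n κ hx
    (by rwa [norm_polarPoint hR.le])).hasFDerivAt
  have hc : HasDerivAt (fun r : ℝ => polarPoint r θ) (radialUnit θ) R := by
    simp only [polarPoint_eq_smul]
    simpa using (hasDerivAt_id R).smul_const (radialUnit θ)
  have h1 := hd.comp_hasDerivAt R hc
  have h2 : HasDerivAt (fun r : ℝ => hankel1 n (κ * r) * Complex.exp (Complex.I * n * θ))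
      (κ * deriv (hankel1 n) (κ * R) * Complex.exp (Complex.I * n * θ)) R := by
    have h3 := hH.hasDerivAt.scomp R ((hasDerivAt_id R).const_mul κ)
    refine (h3.mul_const _).congr_deriv ?_
    simp
  refine h1.unique (h2.congr_of_eventuallyEq ?_)
  filter_upwards [lt_mem_nhds hR] with r hr
  exact cylindricalWave_polarPoint n κ hr θ

/-- The circle of radius `R` is traversed with velocity `R` times the tangential unit vector. This
is the origin of the factor `1 / R` that makes this component small. -/
theorem fderiv_cylindricalWave_angularUnit (hR : 0 < R) (θ : ℝ)
    (hH : DifferentiableAt ℝ (hankel1 n) (κ * R)) :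
    fderiv ℝ (cylindricalWave n κ) (polarPoint R θ) (angularUnit θ) =
      Complex.I * n / R * hankel1 n (κ * R) * Complex.exp (Complex.I * n * θ) := by
  have hx : polarPoint R θ ≠ 0 := by
    rw [← norm_ne_zero_iff, norm_polarPoint hR.le]; exact hR.ne'
  have hR' : (R : ℂ) ≠ 0 := by exact_mod_cast hR.ne'
  have hd := (differentiableAt_cylindricalWave n κ hx
    (by rwa [norm_polarPoint hR.le])).hasFDerivAt
  have hc : HasDerivAt (fun t : ℝ => polarPoint R t) (R • angularUnit θ) θ := by
    simp only [polarPoint_eq_smul]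
    exact (hasDerivAt_radialUnit θ).const_smul R
  have h1 := hd.comp_hasDerivAt θ hc
  have h2 : HasDerivAt (fun t : ℝ => hankel1 n (κ * R) * Complex.exp (Complex.I * n * t))
      (hankel1 n (κ * R) * (Complex.exp (Complex.I * n * θ) * (Complex.I * n * 1))) θ :=
    (((Complex.ofRealCLM.hasDerivAt (x := θ)).const_mul (Complex.I * n)).cexp).const_mul _
  have h3 := h1.unique (h2.congr_of_eventuallyEq
    (Eventually.of_forall fun t => cylindricalWave_polarPoint n κ hR t))
  rw [map_smul, Complex.real_smul] at h3
  field_simp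
  rw [mul_comm, h3]
  ring

theorem partialDeriv_zero_eq (f : Plane → ℂ) (x : Plane) (θ : ℝ) :
    partialDeriv 0 f x = Real.cos θ * fderiv ℝ f x (radialUnit θ) -
      Real.sin θ * fderiv ℝ f x (angularUnit θ) := by
  have h : EuclideanSpace.single (0 : Fin 2) (1 : ℝ) =
      Real.cos θ • radialUnit θ - Real.sin θ • angularUnit θ := by
    ext i
    fin_cases i
    · simp [radialUnit, angularUnit, ← sq]
    · simp [radialUnit, angularUnit, mul_comm]
  rw [partialDeriv, h, map_sub, map_smul, map_smul, Complex.real_smul, Complex.real_smul]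

theorem partialDeriv_one_eq (f : Plane → ℂ) (x : Plane) (θ : ℝ) :
    partialDeriv 1 f x = Real.sin θ * fderiv ℝ f x (radialUnit θ) +
      Real.cos θ * fderiv ℝ f x (angularUnit θ) := by
  have h : EuclideanSpace.single (1 : Fin 2) (1 : ℝ) =
      Real.sin θ • radialUnit θ + Real.cos θ • angularUnit θ := by
    ext i
    fin_cases i
    · simp [radialUnit, angularUnit, mul_comm]
    · simp [radialUnit, angularUnit, ← sq]
  rw [partialDeriv, h, map_add, map_smul, map_smul, Complex.real_smul, Complex.real_smul]

end Partials

/-- The radial amplitude of the cylindrical elastic wave of mode `α` and order `n` on the circle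
of radius `R`. -/
noncomputable def radialAmplitude (B : ElasticBackground) (n : ℤ) (R : ℝ) : WaveMode → ℂ
  | .P => B.κ .P * deriv (hankel1 n) (B.κ .P * R)
  | .S => Complex.I * n / R * hankel1 n (B.κ .S * R)

/-- The tangential amplitude of the cylindrical elastic wave of mode `α` and order `n` on the
circle of radius `R`. -/
noncomputable def angularAmplitude (B : ElasticBackground) (n : ℤ) (R : ℝ) : WaveMode → ℂ
  | .P => Complex.I * n / R * hankel1 n (B.κ .P * R)
  | .S => -(B.κ .S * deriv (hankel1 n) (B.κ .S * R))

/-- The curl is the gradient turned by `-π/2`, so the radial and tangential amplitudes are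
exchanged, up to a sign, between the modes P and S. -/
theorem cylindricalElasticWave_polarPoint (B : ElasticBackground) (α : WaveMode) (n : ℤ) {R : ℝ}
    (hR : 0 < R) (θ : ℝ) (hH : DifferentiableAt ℝ (hankel1 n) (B.κ α * R)) :
    cylindricalElasticWave B α n (polarPoint R θ) =
      ![(radialAmplitude B n R α * Real.cos θ - angularAmplitude B n R α * Real.sin θ) *
          Complex.exp (Complex.I * n * θ),
        (radialAmplitude B n R α * Real.sin θ + angularAmplitude B n R α * Real.cos θ) *
          Complex.exp (Complex.I * n * θ)] := by
  cases α
  · rw [cylindricalElasticWave, planeGrad, partialDeriv_zero_eq _ _ θ, partialDeriv_one_eq _ _ θ,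
      fderiv_cylindricalWave_radialUnit hR θ hH, fderiv_cylindricalWave_angularUnit hR θ hH]
    simp only [radialAmplitude, angularAmplitude]
    congr 1
    · ring
    · congr 1; ring
  · rw [cylindricalElasticWave, planeCurl, partialDeriv_zero_eq _ _ θ, partialDeriv_one_eq _ _ θ,
      fderiv_cylindricalWave_radialUnit hR θ hH, fderiv_cylindricalWave_angularUnit hR θ hH]
    simp only [radialAmplitude, angularAmplitude]
    congr 1
    · ring
    · congr 1; ring

/-- The Hermitian product of two elastic waves on a circle, in terms of the polar amplitudes. -/
theorem sum_cylindricalElasticWave_mul_star (B : ElasticBackground) (α β : WaveMode) (m n : ℤ)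
    {R : ℝ} (hR : 0 < R) (θ : ℝ) (hm : DifferentiableAt ℝ (hankel1 m) (B.κ α * R))
    (hn : DifferentiableAt ℝ (hankel1 n) (B.κ β * R)) :
    ∑ j : Fin 2, cylindricalElasticWave B α m (polarPoint R θ) j *
        star (cylindricalElasticWave B β n (polarPoint R θ) j) =
      (radialAmplitude B m R α * star (radialAmplitude B n R β) +
        angularAmplitude B m R α * star (angularAmplitude B n R β)) *
        Complex.exp (Complex.I * (m - n : ℤ) * θ) := by
  have h1 : star (Complex.exp (Complex.I * n * θ)) = Complex.exp (-(Complex.I * n * θ)) := by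
    rw [Complex.star_def, ← Complex.exp_conj]
    simp
  have h2 : Complex.exp (Complex.I * (m - n : ℤ) * θ) =
      Complex.exp (Complex.I * m * θ) * Complex.exp (-(Complex.I * n * θ)) := by
    rw [← Complex.exp_add]; push_cast; ring_nf
  have h3 : (Real.sin θ : ℂ) ^ 2 + (Real.cos θ : ℂ) ^ 2 = 1 := by
    exact_mod_cast Real.sin_sq_add_cos_sq θ
  have hs : star (Real.sin θ : ℂ) = Real.sin θ := Complex.conj_ofReal _
  have hc : star (Real.cos θ : ℂ) = Real.cos θ := Complex.conj_ofReal _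
  rw [cylindricalElasticWave_polarPoint B α m hR θ hm,
    cylindricalElasticWave_polarPoint B β n hR θ hn, h2, Fin.sum_univ_two]
  simp only [Matrix.cons_val_zero, Matrix.cons_val_one, star_mul', star_add, star_sub, h1, hs, hc]
  linear_combination (radialAmplitude B m R α * star (radialAmplitude B n R β) +
        angularAmplitude B m R α * star (angularAmplitude B n R β)) *
    Complex.exp (Complex.I * m * θ) * Complex.exp (-(Complex.I * n * θ)) * h3

/-! ### The Gram matrices of the source and receiver matrices -/

/-- Discrete orthogonality of the exponentials over equidistributed angles. -/
theorem sum_exp_equiAngle {N : ℕ} (k : ℤ) (hk : |k| < N) :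
    ∑ j : Fin N, Complex.exp (Complex.I * k * equiAngle N j) = if k = 0 then (N : ℂ) else 0 := by
  split_ifs with h0
  · simp [h0]
  have hN : (N : ℂ) ≠ 0 := by
    have : 0 < (N : ℤ) := (abs_nonneg k).trans_lt hk
    exact_mod_cast this.ne'
  set ζ := Complex.exp (2 * π * Complex.I * k / N) with hζ
  -- The angles are `2π(j + 1)/N`, hence an extra factor `ζ` in front of the geometric sum.
  have hterm : ∀ j : Fin N, Complex.exp (Complex.I * k * equiAngle N j) = ζ * ζ ^ (j : ℕ) := by
    intro j
    rw [← pow_succ', hζ, ← Complex.exp_nat_mul]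
    congr 1
    simp only [equiAngle]
    push_cast
    field_simp
  have hζN : ζ ^ N = 1 := by
    rw [hζ, ← Complex.exp_nat_mul, Complex.exp_eq_one_iff]
    exact ⟨k, by field_simp⟩
  have hζ1 : ζ ≠ 1 := by
    rw [hζ, Ne, Complex.exp_eq_one_iff]
    rintro ⟨m, hm⟩
    have h2 : (2 * π * Complex.I : ℂ) ≠ 0 := Complex.two_pi_I_ne_zero
    have h3 : (2 * π * Complex.I : ℂ) * k = 2 * π * Complex.I * (m * N) := by
      field_simp at hm
      linear_combination (2 * π * Complex.I : ℂ) * hm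
    have h4 : k = m * N := by exact_mod_cast mul_left_cancel₀ h2 h3
    exact h0 (Int.eq_zero_of_abs_lt_dvd ⟨m, by rw [h4, mul_comm]⟩ hk)
  simp only [hterm]
  rw [← Finset.mul_sum, Fin.sum_univ_eq_sum_range (fun j => ζ ^ j), geom_sum_eq hζ1, hζN]
  simp

/-- Orders lie in `[-K, K]`, so they differ by at most `2K`; with fewer than `2K + 1` angles
distinct orders could be aliased. -/
theorem abs_order_sub_lt {K N : ℕ} (hN : 2 * K + 1 ≤ N) (p q : ModeIndex K) :
    |p.order - q.order| < (N : ℤ) := by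
  have h : ∀ i j : Fin (2 * K + 1), |modeOrder K i - modeOrder K j| < (N : ℤ) := by
    intro i j
    simp only [modeOrder]
    rw [abs_lt]
    omega
  rcases p with p | p <;> rcases q with q | q <;> exact h p q

theorem modeOrder_injective (K : ℕ) : Function.Injective (modeOrder K) := by
  intro i j hij
  simp only [modeOrder] at hij
  omega

theorem ModeIndex.ext {K : ℕ} {p q : ModeIndex K} (hm : p.mode = q.mode)
    (ho : p.order = q.order) : p = q := by
  rcases p with p | p <;> rcases q with q | q
  · exact congrArg _ (modeOrder_injective K ho)
  · cases hm
  · cases hm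
  · exact congrArg _ (modeOrder_injective K ho)

theorem ElasticBackground.c_pos (B : ElasticBackground) (α : WaveMode) : 0 < B.c α := by
  have h1 := B.ρ_pos
  have h2 := B.lam_pos
  have h3 := B.mu_pos
  cases α
  · exact Real.sqrt_pos.2 (by positivity)
  · exact Real.sqrt_pos.2 (by positivity)

theorem ElasticBackground.κ_pos (B : ElasticBackground) (α : WaveMode) : 0 < B.κ α :=
  div_pos B.ω_pos (B.c_pos α)

/-- This strict inequality separates the P and S modes of the same order in the limit, and so fixes
their singular directions. -/
theorem ElasticBackground.κ_P_lt_κ_S (B : ElasticBackground) : B.κ .P < B.κ .S := by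
  have h1 := B.ρ_pos
  have h2 := B.lam_pos
  have h3 := B.mu_pos
  refine div_lt_div_of_pos_left B.ω_pos (B.c_pos .S) ?_
  refine Real.sqrt_lt_sqrt (by positivity) ?_
  gcongr
  linarith

/-! ### The Gram matrix of the sources -/

theorem star_exp_I_mul (m : ℤ) (y : ℝ) :
    star (Complex.exp (Complex.I * m * y)) = Complex.exp (-(Complex.I * m * y)) := by
  rw [Complex.star_def, ← Complex.exp_conj]
  simp

/-- The constant modulus of the entries of the block of `X` of mode `α`. -/
noncomputable def sourceModulus (B : ElasticBackground) (α : WaveMode) : ℝ :=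
  1 / (4 * B.ρ ^ 2 * B.ω ^ 2 * B.c α ^ 2 * B.κ α)

theorem sourceModulus_pos (B : ElasticBackground) (α : WaveMode) : 0 < sourceModulus B α := by
  have h1 := B.ρ_pos
  have h2 := B.ω_pos
  have h3 := B.c_pos α
  have h4 := B.κ_pos α
  unfold sourceModulus
  positivity

theorem sourceCoeff_eq (B : ElasticBackground) (α : WaveMode) (m : ℤ) (θ : ℝ) :
    sourceCoeff B α m θ = sourceModulus B α *
      Complex.exp (Complex.I * m * ((π / 2 - θ : ℝ) : ℂ)) := by
  have h1 : (B.ρ : ℂ) ≠ 0 := by exact_mod_cast B.ρ_pos.ne'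
  have h2 : (B.ω : ℂ) ≠ 0 := by exact_mod_cast B.ω_pos.ne'
  have h3 : (B.c α : ℂ) ≠ 0 := by exact_mod_cast (B.c_pos α).ne'
  have h4 : (B.κ α : ℂ) ≠ 0 := by exact_mod_cast (B.κ_pos α).ne'
  rw [sourceCoeff, planeWaveCoeff, sourceModulus]
  push_cast
  field_simp
  rw [Complex.I_sq]
  ring

/-- The offset `δ` enters only through a phase that does not depend on the direction, so it comes
out of the sum over directions and disappears when the orders agree. -/
theorem star_sourceCoeff_mul (B : ElasticBackground) (α : WaveMode) (m n : ℤ) (θ δ : ℝ) :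
    star (sourceCoeff B α m (θ + δ)) * sourceCoeff B α n (θ + δ) =
      (sourceModulus B α ^ 2 : ℝ) * Complex.exp (Complex.I * (n - m : ℤ) * ((π / 2 - δ : ℝ) : ℂ)) *
        Complex.exp (Complex.I * (m - n : ℤ) * θ) := by
  have h1 : star (Complex.exp (Complex.I * m * ((π / 2 - (θ + δ) : ℝ) : ℂ))) =
      Complex.exp (-(Complex.I * m * ((π / 2 - (θ + δ) : ℝ) : ℂ))) := star_exp_I_mul m _
  have h2 : Complex.exp (-(Complex.I * m * ((π / 2 - (θ + δ) : ℝ) : ℂ))) *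
      Complex.exp (Complex.I * n * ((π / 2 - (θ + δ) : ℝ) : ℂ)) =
      Complex.exp (Complex.I * (n - m : ℤ) * ((π / 2 - δ : ℝ) : ℂ)) *
        Complex.exp (Complex.I * (m - n : ℤ) * θ) := by
    rw [← Complex.exp_add, ← Complex.exp_add]
    push_cast; ring_nf
  have h3 : star (sourceModulus B α : ℂ) = sourceModulus B α := Complex.conj_ofReal _
  rw [sourceCoeff_eq, sourceCoeff_eq, star_mul', h1, h3]
  push_cast at h2 ⊢
  linear_combination (sourceModulus B α : ℂ) ^ 2 * h2

theorem sum_star_sourceCoeff_mul (B : ElasticBackground) (α : WaveMode) (δ : ℝ) {N : ℕ} {m n : ℤ}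
    (hmn : |m - n| < (N : ℤ)) :
    ∑ s : Fin N, star (sourceCoeff B α m (equiAngle N s + δ)) *
        sourceCoeff B α n (equiAngle N s + δ) =
      if m = n then ((N * sourceModulus B α ^ 2 : ℝ) : ℂ) else 0 := by
  simp only [star_sourceCoeff_mul]
  rw [← Finset.mul_sum, sum_exp_equiAngle _ hmn]
  by_cases h : m = n
  · subst h
    simp [mul_comm]
  · simp [h, sub_ne_zero.2 h]

theorem sourceMatrix_gram (B : ElasticBackground) {K N : ℕ} (hN : 2 * K + 1 ≤ N) (δ : ℝ)
    (p q : ModeIndex K) :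
    ∑ s, star (sourceMatrix B K N δ s p) * sourceMatrix B K N δ s q =
      if p = q then ((N * sourceModulus B p.mode ^ 2 : ℝ) : ℂ) else 0 := by
  have hlt := abs_order_sub_lt hN p q
  have hpq : ∀ (h : p.mode = q.mode), (p.order = q.order ↔ p = q) := fun h =>
    ⟨ModeIndex.ext h, fun h => h ▸ rfl⟩
  rw [Fintype.sum_sum_type]
  rcases p with p | p <;> rcases q with q | q
  · have h := sum_star_sourceCoeff_mul B .P δ hlt
    simp only [hpq rfl] at h
    refine Eq.trans ?_ h
    simp [sourceMatrix, sourceBlock, ModeIndex.order]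
  · simp [sourceMatrix]
  · simp [sourceMatrix]
  · have h := sum_star_sourceCoeff_mul B .S δ hlt
    simp only [hpq rfl] at h
    refine Eq.trans ?_ h
    simp [sourceMatrix, sourceBlock, ModeIndex.order]

/-! ### The Gram matrix of the receivers -/

/-- Parseval's identity in an orthonormal basis of real vectors of the plane. -/
theorem parseval_orthonormal_pair {d e : Plane} (hd : ‖d‖ = 1) (he : ‖e‖ = 1)
    (hde : inner ℝ d e = 0) (u v : Fin 2 → ℂ) :
    star (∑ j, star (u j) * ((d j : ℝ) : ℂ)) * (∑ j, star (v j) * ((d j : ℝ) : ℂ)) +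
      star (∑ j, star (u j) * ((e j : ℝ) : ℂ)) * (∑ j, star (v j) * ((e j : ℝ) : ℂ)) =
      ∑ j, u j * star (v j) := by
  have h1 : d 0 ^ 2 + d 1 ^ 2 = 1 := by
    have h := EuclideanSpace.real_norm_sq_eq d
    rw [hd, Fin.sum_univ_two] at h
    linarith
  have h2 : e 0 ^ 2 + e 1 ^ 2 = 1 := by
    have h := EuclideanSpace.real_norm_sq_eq e
    rw [he, Fin.sum_univ_two] at h
    linarith
  have h3 : d 0 * e 0 + d 1 * e 1 = 0 := by
    have h : inner ℝ d e = e 0 * d 0 + e 1 * d 1 := by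
      simp [PiLp.inner_apply, Fin.sum_univ_two]
    linarith
  -- Orthonormal rows of a square matrix force orthonormal columns, and these column relations are
  -- what the identity uses.
  have hM : !![d 0, d 1; e 0, e 1] * !![d 0, e 0; d 1, e 1] = 1 := by
    ext i j
    fin_cases i <;> fin_cases j <;> simp [Matrix.mul_apply, Fin.sum_univ_two] <;> linarith
  have hM' := mul_eq_one_comm.1 hM
  have h00 : d 0 * d 0 + e 0 * e 0 = 1 := by
    simpa [Matrix.mul_apply, Fin.sum_univ_two] using congrFun (congrFun hM' 0) 0
  have h11 : d 1 * d 1 + e 1 * e 1 = 1 := by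
    simpa [Matrix.mul_apply, Fin.sum_univ_two] using congrFun (congrFun hM' 1) 1
  have h01 : d 0 * d 1 + e 0 * e 1 = 0 := by
    simpa [Matrix.mul_apply, Fin.sum_univ_two] using congrFun (congrFun hM' 0) 1
  have c00 : (d 0 : ℂ) * d 0 + e 0 * e 0 = 1 := by
    rw [← Complex.ofReal_mul, ← Complex.ofReal_mul, ← Complex.ofReal_add, h00, Complex.ofReal_one]
  have c11 : (d 1 : ℂ) * d 1 + e 1 * e 1 = 1 := by
    rw [← Complex.ofReal_mul, ← Complex.ofReal_mul, ← Complex.ofReal_add, h11, Complex.ofReal_one]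
  have c01 : (d 0 : ℂ) * d 1 + e 0 * e 1 = 0 := by
    rw [← Complex.ofReal_mul, ← Complex.ofReal_mul, ← Complex.ofReal_add, h01, Complex.ofReal_zero]
  have hr : ∀ r : ℝ, star (r : ℂ) = r := Complex.conj_ofReal
  simp only [Fin.sum_univ_two, star_add, star_mul', star_star, hr]
  linear_combination (u 0 * star (v 0)) * c00 + (u 1 * star (v 1)) * c11 +
    (u 0 * star (v 1) + u 1 * star (v 0)) * c01

theorem receiverMatrix_inl (B : ElasticBackground) {K N : ℕ} (R : ℝ) (d e : Fin N → Plane)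
    (r : Fin N) (q : ModeIndex K) :
    receiverMatrix B K N R d e (.inl r) q =
      ∑ j : Fin 2, star (cylindricalElasticWave B q.mode q.order (polarPoint R (equiAngle N r)) j) *
        ((d r j : ℝ) : ℂ) := by
  cases q <;> rfl

theorem receiverMatrix_inr (B : ElasticBackground) {K N : ℕ} (R : ℝ) (d e : Fin N → Plane)
    (r : Fin N) (q : ModeIndex K) :
    receiverMatrix B K N R d e (.inr r) q =
      ∑ j : Fin 2, star (cylindricalElasticWave B q.mode q.order (polarPoint R (equiAngle N r)) j) *
        ((e r j : ℝ) : ℂ) := by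
  cases q <;> rfl

/-- The product of the polar amplitudes of two modes on the circle of radius `R`. -/
noncomputable def amplitudeProduct (B : ElasticBackground) {K : ℕ} (R : ℝ) (p q : ModeIndex K) :
    ℂ :=
  radialAmplitude B p.order R p.mode * star (radialAmplitude B q.order R q.mode) +
    angularAmplitude B p.order R p.mode * star (angularAmplitude B q.order R q.mode)

/-- Parseval at each receiver leaves the Hermitian product of the two waves, whose dependence on the
angle is a pure exponential. The sum over receivers then decouples distinct orders exactly, at
finite `R`. -/
theorem receiverMatrix_gram (B : ElasticBackground) {K N : ℕ} (hN : 2 * K + 1 ≤ N)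
    {d e : Fin N → Plane} (hd : ∀ r, ‖d r‖ = 1) (he : ∀ r, ‖e r‖ = 1)
    (hde : ∀ r, inner ℝ (d r) (e r) = 0) {R : ℝ} (hR : 0 < R)
    (hH : ∀ p : ModeIndex K, DifferentiableAt ℝ (hankel1 p.order) (B.κ p.mode * R))
    (p q : ModeIndex K) :
    ∑ r, star (receiverMatrix B K N R d e r p) * receiverMatrix B K N R d e r q =
      if p.order = q.order then N * amplitudeProduct B R p q else 0 := by
  rw [Fintype.sum_sum_type, ← Finset.sum_add_distrib]
  simp only [receiverMatrix_inl, receiverMatrix_inr]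
  have h : ∀ r, _ := fun r => parseval_orthonormal_pair (hd r) (he r) (hde r)
    (cylindricalElasticWave B p.mode p.order (polarPoint R (equiAngle N r)))
    (cylindricalElasticWave B q.mode q.order (polarPoint R (equiAngle N r)))
  simp only [h]
  simp only [fun θ => sum_cylindricalElasticWave_mul_star B p.mode q.mode p.order q.order hR θ
    (hH p) (hH q)]
  rw [← Finset.mul_sum, sum_exp_equiAngle _ (abs_order_sub_lt hN p q)]
  by_cases hpq : p.order = q.order
  · simp [hpq, amplitudeProduct, mul_comm]
  · simp [hpq, sub_ne_zero.2 hpq]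

/-! ### Asymptotics of the Gram matrix of the receivers -/

/-- The square `N κ_β² |(H⁽¹⁾_n)'(κ_β R)|²` of the asymptotic norm of a column of `Y`. -/
noncomputable def receiverNormSq (B : ElasticBackground) {K : ℕ} (N : ℕ) (R : ℝ)
    (q : ModeIndex K) : ℝ :=
  N * (B.κ q.mode * ‖deriv (hankel1 q.order) (B.κ q.mode * R)‖) ^ 2

theorem tendsto_sqrt_mul_norm_comp {f : ℝ → ℂ} {L κ : ℝ} (hκ : 0 < κ)
    (h : Tendsto (fun x => √x * ‖f x‖) atTop (𝓝 L)) :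
    Tendsto (fun R => √R * ‖f (κ * R)‖) atTop (𝓝 ((√κ)⁻¹ * L)) := by
  have h1 := (h.comp (tendsto_id.const_mul_atTop hκ)).const_mul (√κ)⁻¹
  refine h1.congr fun R => ?_
  have h2 : √κ ≠ 0 := by positivity
  rw [Function.comp_apply, id, Real.sqrt_mul hκ.le]
  field_simp

/-- The limit depends on the mode but not on the order: one factor `κ` of `κ²` is used up by
`|H'(κR)|² ~ 2/(π κ R)`. -/
theorem tendsto_mul_receiverNormSq (B : ElasticBackground) {K : ℕ} (N : ℕ) (q : ModeIndex K) :
    Tendsto (fun R => R * receiverNormSq B N R q) atTop (𝓝 (N * B.κ q.mode * (2 / π))) := by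
  have hκ := B.κ_pos q.mode
  have h1 := ((((tendsto_sqrt_mul_norm_comp hκ
    (tendsto_sqrt_mul_norm_deriv_hankel1 q.order)).const_mul (B.κ q.mode)).pow 2).const_mul (N : ℝ))
  have h2 : (N : ℝ) * (B.κ q.mode * ((√(B.κ q.mode))⁻¹ * √(2 / π))) ^ 2 =
      N * B.κ q.mode * (2 / π) := by
    rw [mul_pow, mul_pow, inv_pow, Real.sq_sqrt hκ.le, Real.sq_sqrt (by positivity)]
    field_simp
  rw [h2] at h1
  refine h1.congr' ?_
  filter_upwards [eventually_gt_atTop 0] with R hR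
  rw [receiverNormSq]
  linear_combination ((N : ℝ) * (B.κ q.mode * ‖deriv (hankel1 q.order) (B.κ q.mode * R)‖) ^ 2) *
    Real.sq_sqrt hR.le

theorem isBigO_inv_sqrt_comp {f : ℝ → ℂ} {L κ : ℝ} (hκ : 0 < κ)
    (h : Tendsto (fun x => √x * ‖f x‖) atTop (𝓝 L)) :
    (fun R => f (κ * R)) =O[atTop] fun R : ℝ => (√R)⁻¹ :=
  isBigO_of_tendsto_sqrt_mul_norm (tendsto_sqrt_mul_norm_comp hκ h)

theorem isBigO_main_amplitude (B : ElasticBackground) (n : ℤ) (α : WaveMode) :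
    (fun R : ℝ => (B.κ α : ℂ) * deriv (hankel1 n) (B.κ α * R)) =O[atTop] fun R : ℝ => (√R)⁻¹ :=
  (isBigO_inv_sqrt_comp (B.κ_pos α) (tendsto_sqrt_mul_norm_deriv_hankel1 n)).const_mul_left _

theorem isBigO_small_amplitude (B : ElasticBackground) (n : ℤ) (α : WaveMode) :
    (fun R : ℝ => Complex.I * n / R * hankel1 n (B.κ α * R)) =O[atTop]
      fun R : ℝ => R⁻¹ * (√R)⁻¹ := by
  refine IsBigO.mul ?_ (isBigO_inv_sqrt_comp (B.κ_pos α) (tendsto_sqrt_mul_norm_hankel1 n))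
  have h1 : (fun R : ℝ => ((R⁻¹ : ℝ) : ℂ)) =O[atTop] fun R : ℝ => R⁻¹ :=
    Complex.isBigO_ofReal_left.2 (isBigO_refl _ _)
  refine (h1.const_mul_left (Complex.I * n)).congr_left fun R => ?_
  push_cast
  rw [div_eq_mul_inv]

theorem isBigO_star {f : ℝ → ℂ} {g : ℝ → ℝ} (h : f =O[atTop] g) :
    (fun R => star (f R)) =O[atTop] g :=
  (isBigO_norm_left.2 h).congr_left (fun R => (norm_star (f R)).symm) |>.of_norm_left

theorem isBigO_mul_small {f g : ℝ → ℂ} (hf : f =O[atTop] fun R : ℝ => (√R)⁻¹)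
    (hg : g =O[atTop] fun R : ℝ => R⁻¹ * (√R)⁻¹) :
    (fun R => f R * g R) =O[atTop] fun R : ℝ => (R ^ 2)⁻¹ := by
  refine (hf.mul hg).congr' EventuallyEq.rfl ?_
  filter_upwards [eventually_gt_atTop 0] with R hR
  have h1 := Real.sq_sqrt hR.le
  have h2 : √R ≠ 0 := by positivity
  field_simp
  linarith

theorem isBigO_small_of_small {g : ℝ → ℂ} (hg : g =O[atTop] fun R : ℝ => R⁻¹ * (√R)⁻¹) :
    g =O[atTop] fun R : ℝ => (√R)⁻¹ := by
  refine hg.trans (IsBigO.of_bound 1 ?_)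
  filter_upwards [eventually_ge_atTop 1] with R hR
  rw [norm_mul, norm_inv, Real.norm_of_nonneg (by linarith : (0 : ℝ) ≤ R)]
  gcongr
  exact inv_le_one_of_one_le₀ hR

/-- The large component contributes exactly the main term, so the error is the squared modulus of
the small component. It is even `O(R^{-3})`, but `O(R^{-2})` suffices. -/
theorem amplitudeProduct_self_sub_isBigO (B : ElasticBackground) {K : ℕ} (N : ℕ)
    (q : ModeIndex K) :
    (fun R => N * amplitudeProduct B R q q - (receiverNormSq B N R q : ℂ)) =O[atTop]
      fun R : ℝ => (R ^ 2)⁻¹ := by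
  have hs := isBigO_small_amplitude B q.order q.mode
  have h1 := (isBigO_mul_small (isBigO_small_of_small hs) (isBigO_star hs)).const_mul_left (N : ℂ)
  refine h1.congr_left fun R => ?_
  have hz : ∀ z : ℂ, z * star z = (‖z‖ : ℂ) ^ 2 := Complex.mul_conj'
  have hκ : ‖(B.κ q.mode : ℂ)‖ = B.κ q.mode := by
    rw [Complex.norm_real, Real.norm_of_nonneg (B.κ_pos _).le]
  have hz' : ((B.κ q.mode : ℂ) * deriv (hankel1 q.order) (B.κ q.mode * R)) *
      star ((B.κ q.mode : ℂ) * deriv (hankel1 q.order) (B.κ q.mode * R)) =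
      (B.κ q.mode * ‖deriv (hankel1 q.order) (B.κ q.mode * R)‖) ^ 2 := by
    rw [hz, norm_mul, hκ]
    push_cast
    rfl
  have hq : amplitudeProduct B R q q =
      ((B.κ q.mode : ℂ) * deriv (hankel1 q.order) (B.κ q.mode * R)) *
      star ((B.κ q.mode : ℂ) * deriv (hankel1 q.order) (B.κ q.mode * R)) +
      (Complex.I * q.order / R * hankel1 q.order (B.κ q.mode * R)) *
      star (Complex.I * q.order / R * hankel1 q.order (B.κ q.mode * R)) := by
    rw [amplitudeProduct]
    cases q
    · rfl
    · simp only [ModeIndex.mode, radialAmplitude, angularAmplitude, star_neg]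
      ring
  rw [hq, hz', receiverNormSq]
  push_cast
  ring

/-- For different modes each component is large in one wave and small in the other, so both products
have size `R^{-1/2} · R^{-3/2}`. -/
theorem amplitudeProduct_isBigO (B : ElasticBackground) {K : ℕ} {p q : ModeIndex K}
    (hpq : p.mode ≠ q.mode) :
    (fun R => amplitudeProduct B R p q) =O[atTop] fun R : ℝ => (R ^ 2)⁻¹ := by
  have hsm := fun r : ModeIndex K => isBigO_small_amplitude B r.order r.mode
  have hma := fun r : ModeIndex K => isBigO_main_amplitude B r.order r.mode
  have h1 := isBigO_mul_small (hma p) (isBigO_star (hsm q))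
  have h2 := isBigO_mul_small (isBigO_star (hma q)) (hsm p)
  rcases p with p | p <;> rcases q with q | q
  · exact absurd rfl hpq
  · refine (h1.sub h2).congr_left fun R => ?_
    simp only [amplitudeProduct, ModeIndex.mode, radialAmplitude, angularAmplitude, star_neg]
    ring
  · refine (h2.sub h1).congr_left fun R => ?_
    simp only [amplitudeProduct, ModeIndex.mode, radialAmplitude, angularAmplitude]
    ring
  · exact absurd rfl hpq

theorem eventually_differentiableAt_hankel1_modes (B : ElasticBackground) (K : ℕ) :
    ∀ᶠ R in atTop, ∀ p : ModeIndex K,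
      DifferentiableAt ℝ (hankel1 p.order) (B.κ p.mode * R) :=
  eventually_all.2 fun p => (tendsto_id.const_mul_atTop (B.κ_pos p.mode)).eventually
    (eventually_differentiableAt_hankel1 p.order)

theorem receiverMatrix_gram_sub_isBigO (B : ElasticBackground) {K N : ℕ} (hN : 2 * K + 1 ≤ N)
    {d e : Fin N → Plane} (hd : ∀ r, ‖d r‖ = 1) (he : ∀ r, ‖e r‖ = 1)
    (hde : ∀ r, inner ℝ (d r) (e r) = 0) (p q : ModeIndex K) :
    (fun R => ∑ r, star (receiverMatrix B K N R d e r p) * receiverMatrix B K N R d e r q -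
      if p = q then (receiverNormSq B N R q : ℂ) else 0) =O[atTop] fun R : ℝ => (R ^ 2)⁻¹ := by
  have hgram : (fun R => (if p.order = q.order then N * amplitudeProduct B R p q else 0) -
      if p = q then (receiverNormSq B N R q : ℂ) else 0) =ᶠ[atTop]
      (fun R => ∑ r, star (receiverMatrix B K N R d e r p) * receiverMatrix B K N R d e r q -
      if p = q then (receiverNormSq B N R q : ℂ) else 0) := by
    filter_upwards [eventually_gt_atTop 0, eventually_differentiableAt_hankel1_modes B K]
      with R hR hH
    rw [receiverMatrix_gram B hN hd he hde hR hH]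
  refine IsBigO.congr' ?_ hgram EventuallyEq.rfl
  by_cases ho : p.order = q.order
  · by_cases hm : p.mode = q.mode
    · obtain rfl := ModeIndex.ext hm ho
      simpa using amplitudeProduct_self_sub_isBigO B N p
    · have hpq : p ≠ q := fun h => hm (h ▸ rfl)
      simpa [ho, hpq] using (amplitudeProduct_isBigO B hm).const_mul_left (N : ℂ)
  · have hpq : p ≠ q := fun h => ho (h ▸ rfl)
    simpa [ho, hpq] using isBigO_zero _ _

/-! ### Singular value decompositions of `M ↦ X M Y*` -/

section ConjOperator

variable {a b c d : Type*}

/-- The matrix `e_p w*`. -/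
def rankOneMatrix [DecidableEq b] (p : b) (w : d → ℂ) : Matrix b d ℂ :=
  Matrix.of fun k l => if k = p then star (w l) else 0

theorem rankOneMatrix_single [DecidableEq b] [DecidableEq d] (p : b) (q : d) :
    rankOneMatrix p (Pi.single q 1) = Matrix.single p q (1 : ℂ) := by
  ext k l
  simp only [rankOneMatrix, Matrix.of_apply, Matrix.single_apply, Pi.single_apply]
  by_cases hk : k = p
  · by_cases hl : l = q
    · simp [hk, hl]
    · simp [hk, hl, Ne.symm hl]
  · simp [hk, Ne.symm hk]

theorem frobeniusInner_rankOneMatrix [Fintype b] [Fintype d] [DecidableEq b] (p p' : b)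
    (w w' : d → ℂ) :
    frobeniusInner (rankOneMatrix p w) (rankOneMatrix p' w') =
      (if p = p' then 1 else 0) * (star w' ⬝ᵥ w) := by
  simp only [frobeniusInner, rankOneMatrix, Matrix.of_apply, dotProduct, Pi.star_apply]
  rw [Finset.sum_eq_single p]
  · by_cases h : p = p'
    · simp [h, mul_comm]
    · simp [h]
  · intro k _ hk
    simp [hk]
  · simp

theorem conjOperator_rankOneMatrix_apply [Fintype b] [Fintype d] [DecidableEq b]
    (X : Matrix a b ℂ) (Y : Matrix c d ℂ)
    (p : b) (w : d → ℂ) (i : a) (j : c) :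
    conjOperator X Y (rankOneMatrix p w) i j = X i p * star ((Y.mulVec w) j) := by
  change (X * rankOneMatrix p w * Y.conjTranspose) i j = _
  simp only [Matrix.mul_apply, rankOneMatrix, Matrix.of_apply, mul_ite, mul_zero,
    Finset.sum_ite_eq', Finset.mem_univ, if_true,
    Matrix.conjTranspose_apply, Matrix.mulVec, dotProduct, star_sum, star_mul', Finset.mul_sum]
  refine Finset.sum_congr rfl fun l _ => ?_
  ring

/-- The Hermitian products of the images of the matrices `e_p w*` factor. -/
theorem frobeniusInner_conjOperator_rankOneMatrix [Fintype a] [Fintype b] [Fintype c] [Fintype d]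
    [DecidableEq b] (X : Matrix a b ℂ)
    (Y : Matrix c d ℂ) (p p' : b) (w w' : d → ℂ) :
    frobeniusInner (conjOperator X Y (rankOneMatrix p w))
        (conjOperator X Y (rankOneMatrix p' w')) =
      (∑ i, star (X i p) * X i p') * (star w' ⬝ᵥ (Y.conjTranspose * Y).mulVec w) := by
  have h : star w' ⬝ᵥ (Y.conjTranspose * Y).mulVec w =
      ∑ j, star ((Y.mulVec w') j) * (Y.mulVec w) j := by
    rw [← Matrix.mulVec_mulVec, Matrix.dotProduct_mulVec, Matrix.vecMul_conjTranspose, star_star]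
    rfl
  rw [h, Finset.sum_mul_sum, frobeniusInner]
  simp only [conjOperator_rankOneMatrix_apply, star_mul', star_star]
  refine Finset.sum_congr rfl fun i _ => Finset.sum_congr rfl fun j _ => ?_
  ring

theorem frobeniusInner_smul_smul [Fintype a] [Fintype b] (r s : ℝ) (M N : Matrix a b ℂ) :
    frobeniusInner ((r : ℂ) • M) ((s : ℂ) • N) = (r * s : ℝ) * frobeniusInner M N := by
  have hr : star (r : ℂ) = r := Complex.conj_ofReal r
  simp only [frobeniusInner, Finset.mul_sum, Matrix.smul_apply, smul_eq_mul, star_mul', hr]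
  refine Finset.sum_congr rfl fun i _ => Finset.sum_congr rfl fun j _ => ?_
  push_cast
  ring

theorem frobeniusInner_sum_right [Fintype a] [Fintype b] {ι : Type*} [Fintype ι]
    (M : Matrix a b ℂ) (g : ι → ℂ)
    (N : ι → Matrix a b ℂ) :
    frobeniusInner M (∑ i, g i • N i) = ∑ i, g i * frobeniusInner M (N i) := by
  simp only [frobeniusInner, Matrix.sum_apply, Matrix.smul_apply, smul_eq_mul, Finset.mul_sum]
  symm
  rw [Finset.sum_comm]
  refine Finset.sum_congr rfl fun k _ => ?_
  rw [Finset.sum_comm]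
  refine Finset.sum_congr rfl fun l _ => Finset.sum_congr rfl fun i _ => ?_
  ring

/-- Pairing a vanishing combination with each member gives linear independence; counting dimensions
does the rest. -/
theorem span_eq_top_of_frobenius_orthonormal [Fintype a] [Fintype b] {ι : Type*} [Fintype ι]
    [DecidableEq ι]
    {V : ι → Matrix a b ℂ}
    (hV : ∀ i j, frobeniusInner (V i) (V j) = if i = j then 1 else 0)
    (hcard : Fintype.card ι = Fintype.card a * Fintype.card b) :
    Submodule.span ℂ (Set.range V) = ⊤ := by
  refine LinearIndependent.span_eq_top_of_card_eq_finrank' ?_ ?_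
  · rw [Fintype.linearIndependent_iff]
    intro g hg i
    have h1 := frobeniusInner_sum_right (V i) g V
    rw [hg] at h1
    have h0 : frobeniusInner (V i) 0 = 0 := by simp [frobeniusInner]
    simpa [hV, h0] using h1.symm
  · rw [Module.finrank_matrix, Module.finrank_self, mul_one, hcard]

/-- Since `X*X` is diagonal and `w` diagonalizes `Y*Y`, the images of the matrices `e_p w_q*` are
orthogonal with squared norms `x p * y q`. Positivity allows normalizing them into left singular
vectors. -/
theorem isSVD_conjOperator [Fintype a] [Fintype b] [Fintype c] [Fintype d] [DecidableEq b]
    [DecidableEq d] {X : Matrix a b ℂ} {Y : Matrix c d ℂ}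
    {x : b → ℝ} {y : d → ℝ} {w : d → d → ℂ} (hx : ∀ p, 0 < x p) (hy : ∀ q, 0 < y q)
    (hX : ∀ p p', ∑ i, star (X i p) * X i p' = if p = p' then (x p : ℂ) else 0)
    (hw : ∀ q q', star (w q) ⬝ᵥ w q' = if q = q' then 1 else 0)
    (hY : ∀ q q', star (w q) ⬝ᵥ (Y.conjTranspose * Y).mulVec (w q') =
      if q = q' then (y q : ℂ) else 0) :
    IsSVD (conjOperator X Y) (fun i : b × d => √(x i.1 * y i.2))
      (fun i => (((√(x i.1 * y i.2))⁻¹ : ℝ) : ℂ) • conjOperator X Y (rankOneMatrix i.1 (w i.2)))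
      (fun i => rankOneMatrix i.1 (w i.2)) := by
  have hort : ∀ i j : b × d, frobeniusInner (rankOneMatrix i.1 (w i.2))
      (rankOneMatrix j.1 (w j.2)) = if i = j then 1 else 0 := by
    intro i j
    rw [frobeniusInner_rankOneMatrix, hw]
    by_cases h1 : i.1 = j.1 <;> by_cases h2 : i.2 = j.2 <;> simp [h1, h2, Prod.ext_iff, Ne.symm]
  have hpos : ∀ i : b × d, 0 < x i.1 * y i.2 := fun i => mul_pos (hx _) (hy _)
  refine ⟨fun i => Real.sqrt_nonneg _, fun i j => ?_, hort,
    span_eq_top_of_frobenius_orthonormal hort (Fintype.card_prod b d), fun i => ?_⟩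
  · rw [frobeniusInner_smul_smul, frobeniusInner_conjOperator_rankOneMatrix, hX, hY]
    by_cases h : i = j
    · subst h
      have h1 : √(x i.1 * y i.2) ≠ 0 := (Real.sqrt_pos.2 (hpos i)).ne'
      have h2 := Real.mul_self_sqrt (hpos i).le
      simp only [if_true]
      rw [← Complex.ofReal_mul, ← Complex.ofReal_mul, ← mul_inv, h2,
        inv_mul_cancel₀ (hpos i).ne', Complex.ofReal_one]
    · rw [if_neg h]
      by_cases h1 : i.1 = j.1
      · have h2 : j.2 ≠ i.2 := fun h2 => h (Prod.ext h1 h2.symm)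
        simp [h2]
      · simp [h1]
  · have h1 : ((√(x i.1 * y i.2) : ℝ) : ℂ) ≠ 0 := by
      exact_mod_cast (Real.sqrt_pos.2 (hpos i)).ne'
    rw [smul_smul, Complex.ofReal_inv, mul_inv_cancel₀ h1, one_smul]

end ConjOperator

/-! ### Simultaneous diagonalization of Hermitian matrices with `2 × 2` blocks -/

/-- The small root of the quadratic equation for the rotation diagonalizing a Hermitian `2 × 2`
matrix with off-diagonal entry `g` and difference `Δ` of the diagonal entries. -/
theorem exists_rotation_parameter (Δ : ℝ) (g : ℂ) :
    ∃ c : ℂ, Δ ≠ 0 → ‖c‖ ≤ ‖g‖ * |Δ|⁻¹ ∧ g - star c * Δ - star c ^ 2 * star g = 0 := by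
  by_cases hΔ : Δ = 0
  · exact ⟨0, fun h => absurd hΔ h⟩
  set D := √(Δ ^ 2 + 4 * ‖g‖ ^ 2)
  have hD : D ^ 2 = Δ ^ 2 + 4 * ‖g‖ ^ 2 := Real.sq_sqrt (by positivity)
  have hDΔ : |Δ| ≤ D := Real.abs_le_sqrt (by nlinarith [sq_nonneg ‖g‖])
  have hΔp : 0 < |Δ| := abs_pos.2 hΔ
  have hΔ2 := sq_abs Δ
  -- With `star c = g t` the equation becomes `‖g‖² t² + Δ t - 1 = 0` when `g ≠ 0`. Its root of
  -- smaller modulus, rationalized to avoid dividing by `g`, is `t = 2Δ / S`, and `|t| ≤ 1/|Δ|`.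
  set S := Δ ^ 2 + |Δ| * D
  have hS : 2 * Δ ^ 2 ≤ S := by
    have : |Δ| * |Δ| ≤ |Δ| * D := by gcongr
    simp only [S]; nlinarith
  have hSp : 0 < S := lt_of_lt_of_le (by positivity) hS
  have hroot : 1 - 2 * Δ / S * Δ - ‖g‖ ^ 2 * (2 * Δ / S) ^ 2 = 0 := by
    field_simp
    simp only [S]
    linear_combination Δ ^ 2 * hD + D ^ 2 * hΔ2
  refine ⟨star g * ((2 * Δ / S : ℝ) : ℂ), fun _ => ⟨?_, ?_⟩⟩
  · rw [norm_mul, norm_star, Complex.norm_real, Real.norm_eq_abs]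
    gcongr
    rw [abs_div, abs_mul, abs_two, abs_of_pos hSp, div_le_iff₀ hSp, inv_mul_eq_div, le_div_iff₀ hΔp]
    nlinarith
  · have hr : star ((2 * Δ / S : ℝ) : ℂ) = ((2 * Δ / S : ℝ) : ℂ) := Complex.conj_ofReal _
    have hz : g * star g = (‖g‖ : ℂ) ^ 2 := Complex.mul_conj' g
    have h1 := congrArg (fun r : ℝ => (r : ℂ)) hroot
    simp only [Complex.ofReal_sub, Complex.ofReal_mul, Complex.ofReal_pow, Complex.ofReal_one,
      Complex.ofReal_zero] at h1
    rw [star_mul', star_star, hr]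
    linear_combination g * h1 - g * ((2 * Δ / S : ℝ) : ℂ) ^ 2 * hz

section Rotation

variable {ι : Type*}

/-- The orthonormal basis obtained from the canonical one by a rotation in each of the planes
spanned by `e (inl i)` and `e (inr i)`. -/
noncomputable def rotatedBasis [DecidableEq ι] (c : ι → ℂ) : ι ⊕ ι → ι ⊕ ι → ℂ
  | .inl i => ((√(1 + ‖c i‖ ^ 2))⁻¹ : ℂ) • Sum.elim (Pi.single i 1) (Pi.single i (c i))
  | .inr i => ((√(1 + ‖c i‖ ^ 2))⁻¹ : ℂ) • Sum.elim (Pi.single i (-star (c i))) (Pi.single i 1)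

theorem one_le_sqrt_one_add (c : ℂ) : 1 ≤ √(1 + ‖c‖ ^ 2) :=
  Real.one_le_sqrt.2 (by nlinarith [sq_nonneg ‖c‖])

theorem abs_inv_sqrt_sub_one_le (c : ℂ) : |(√(1 + ‖c‖ ^ 2))⁻¹ - 1| ≤ ‖c‖ := by
  have h1 := one_le_sqrt_one_add c
  have h2 : √(1 + ‖c‖ ^ 2) ≤ 1 + ‖c‖ := by
    rw [Real.sqrt_le_left (by positivity)]
    nlinarith [norm_nonneg c]
  have h0 : 0 < √(1 + ‖c‖ ^ 2) := by linarith
  have h3 : (√(1 + ‖c‖ ^ 2))⁻¹ ≤ 1 := inv_le_one_of_one_le₀ h1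
  rw [abs_sub_comm, abs_of_nonneg (by linarith)]
  have h4 : 1 - (√(1 + ‖c‖ ^ 2))⁻¹ = (√(1 + ‖c‖ ^ 2) - 1) / √(1 + ‖c‖ ^ 2) := by
    field_simp
  rw [h4, div_le_iff₀ h0]
  nlinarith [norm_nonneg c]

theorem norm_inv_sqrt_mul_le (c : ℂ) : ‖((√(1 + ‖c‖ ^ 2))⁻¹ : ℂ) * c‖ ≤ ‖c‖ := by
  rw [norm_mul, norm_inv, Complex.norm_real, Real.norm_of_nonneg (Real.sqrt_nonneg _)]
  exact mul_le_of_le_one_left (norm_nonneg c) (inv_le_one_of_one_le₀ (one_le_sqrt_one_add c))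

theorem norm_rotatedBasis_sub_le [DecidableEq ι] (c : ι → ℂ) (q l : ι ⊕ ι) :
    ‖rotatedBasis c q l - Pi.single (M := fun _ => ℂ) q 1 l‖ ≤ ‖c (Sum.elim id id q)‖ := by
  have h1 := fun i => abs_inv_sqrt_sub_one_le (c i)
  have h1' : ∀ i, ‖((√(1 + ‖c i‖ ^ 2))⁻¹ : ℂ) - 1‖ ≤ ‖c i‖ := fun i => by
    rw [← Complex.ofReal_inv, ← Complex.ofReal_one, ← Complex.ofReal_sub, Complex.norm_real]
    exact h1 i
  have h2 := fun i => norm_inv_sqrt_mul_le (c i)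
  have h3 := fun i => norm_inv_sqrt_mul_le (star (c i))
  simp only [norm_star] at h3
  rcases q with i | i <;> rcases l with j | j
  · by_cases h : j = i
    · subst h
      simpa [rotatedBasis] using h1' j
    · simp [rotatedBasis, h]
  · by_cases h : j = i
    · subst h
      simpa [rotatedBasis] using h2 j
    · simp [rotatedBasis, h]
  · by_cases h : j = i
    · subst h
      simpa [rotatedBasis] using h3 j
    · simp [rotatedBasis, h]
  · by_cases h : j = i
    · subst h
      simpa [rotatedBasis] using h1' j
    · simp [rotatedBasis, h]

theorem sumElim_single_form [Fintype ι] [DecidableEq ι] (G : Matrix (ι ⊕ ι) (ι ⊕ ι) ℂ) (i j : ι)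
    (s t u v : ℂ) :
    star (Sum.elim (Pi.single i s) (Pi.single i t) : ι ⊕ ι → ℂ) ⬝ᵥ
      G.mulVec (Sum.elim (Pi.single j u) (Pi.single j v)) =
      star s * (G (.inl i) (.inl j) * u + G (.inl i) (.inr j) * v) +
        star t * (G (.inr i) (.inl j) * u + G (.inr i) (.inr j) * v) := by
  have h : ∀ (p : ι ⊕ ι), G.mulVec (Sum.elim (Pi.single j u) (Pi.single j v)) p =
      G p (.inl j) * u + G p (.inr j) * v := by
    intro p
    simp [Matrix.mulVec, dotProduct, Fintype.sum_sum_type, Pi.single_apply]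
  rw [dotProduct, Fintype.sum_sum_type]
  simp only [h, Pi.star_apply, Sum.elim_inl, Sum.elim_inr, Pi.single_apply, apply_ite star,
    star_zero, ite_mul, zero_mul, Finset.sum_ite_eq', Finset.mem_univ, if_true]

theorem smul_form_smul [Fintype ι] (G : Matrix (ι ⊕ ι) (ι ⊕ ι) ℂ) (r s : ℝ) (u v : ι ⊕ ι → ℂ) :
    star (((r : ℂ)⁻¹) • u) ⬝ᵥ G.mulVec (((s : ℂ)⁻¹) • v) =
      (r : ℂ)⁻¹ * (s : ℂ)⁻¹ * (star u ⬝ᵥ G.mulVec v) := by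
  have hr : star ((r : ℂ)⁻¹) = (r : ℂ)⁻¹ := by
    rw [← Complex.ofReal_inv]; exact Complex.conj_ofReal _
  rw [star_smul, hr, Matrix.mulVec_smul, smul_dotProduct, dotProduct_smul, smul_eq_mul, smul_eq_mul,
    mul_assoc]

/-- Different planes do not interact. Within one plane the off-diagonal entry in the rotated basis
is, up to normalization, the left side of the quadratic equation `hc`, or its conjugate. -/
theorem rotatedBasis_form_eq_zero [Fintype ι] [DecidableEq ι] {G : Matrix (ι ⊕ ι) (ι ⊕ ι) ℂ}
    {c : ι → ℂ}
    (hG : ∀ p q, Sum.elim id id p ≠ (Sum.elim id id q : ι) → G p q = 0)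
    (hherm : G.IsHermitian)
    (hc : ∀ i, G (.inl i) (.inr i) - star (c i) * (G (.inl i) (.inl i) - G (.inr i) (.inr i)) -
      star (c i) ^ 2 * star (G (.inl i) (.inr i)) = 0)
    {q q' : ι ⊕ ι} (hq : q ≠ q') :
    star (rotatedBasis c q) ⬝ᵥ G.mulVec (rotatedBasis c q') = 0 := by
  have hd : ∀ {i j : ι}, i ≠ j → G (.inl i) (.inl j) = 0 ∧ G (.inl i) (.inr j) = 0 ∧
      G (.inr i) (.inl j) = 0 ∧ G (.inr i) (.inr j) = 0 := fun h =>
    ⟨hG _ _ h, hG _ _ h, hG _ _ h, hG _ _ h⟩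
  have hs : ∀ i, star (G (.inl i) (.inr i)) = G (.inr i) (.inl i) := fun i => hherm.apply _ _
  have hs1 : ∀ i, star (G (.inl i) (.inl i)) = G (.inl i) (.inl i) := fun i => hherm.apply _ _
  have hs2 : ∀ i, star (G (.inr i) (.inr i)) = G (.inr i) (.inr i) := fun i => hherm.apply _ _
  rcases q with i | i <;> rcases q' with j | j <;>
    simp only [rotatedBasis] <;> rw [smul_form_smul, sumElim_single_form]
  · obtain ⟨h1, h2, h3, h4⟩ := hd (fun h : i = j => hq (h ▸ rfl))
    simp [h1, h2, h3, h4]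
  · by_cases h : i = j
    · subst h
      have h1 := hc i
      rw [hs] at h1
      rw [star_one]
      linear_combination ((√(1 + ‖c i‖ ^ 2) : ℝ) : ℂ)⁻¹ * ((√(1 + ‖c i‖ ^ 2) : ℝ) : ℂ)⁻¹ * h1
    · obtain ⟨h1, h2, h3, h4⟩ := hd h
      simp [h1, h2, h3, h4]
  · by_cases h : i = j
    · subst h
      have h1 := congrArg star (hc i)
      simp only [star_sub, star_mul', star_pow, star_star, star_zero, hs1, hs2] at h1
      rw [hs] at h1
      rw [star_one, star_neg, star_star]
      linear_combination ((√(1 + ‖c i‖ ^ 2) : ℝ) : ℂ)⁻¹ * ((√(1 + ‖c i‖ ^ 2) : ℝ) : ℂ)⁻¹ * h1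
    · obtain ⟨h1, h2, h3, h4⟩ := hd h
      simp [h1, h2, h3, h4]
  · obtain ⟨h1, h2, h3, h4⟩ := hd (fun h : i = j => hq (h ▸ rfl))
    simp [h1, h2, h3, h4]

theorem inv_sqrt_mul_self (c : ℂ) :
    ((√(1 + ‖c‖ ^ 2) : ℝ) : ℂ)⁻¹ * ((√(1 + ‖c‖ ^ 2) : ℝ) : ℂ)⁻¹ * (1 + star c * c) = 1 := by
  have h1 : star c * c = (‖c‖ : ℂ) ^ 2 := Complex.conj_mul' c
  have h2 : (1 + (‖c‖ : ℂ) ^ 2) ≠ 0 := by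
    have : (1 + ‖c‖ ^ 2 : ℝ) ≠ 0 := by positivity
    exact_mod_cast this
  rw [h1, ← mul_inv, ← Complex.ofReal_mul, Real.mul_self_sqrt (by positivity)]
  push_cast
  exact inv_mul_cancel₀ h2

/-- Every term of the correction contains either an off-diagonal entry or `|c|²` times the gap, so
it is small when `c` is. -/
theorem rotatedBasis_form_inl [Fintype ι] [DecidableEq ι] (G : Matrix (ι ⊕ ι) (ι ⊕ ι) ℂ)
    (c : ι → ℂ) (i : ι) :
    star (rotatedBasis c (.inl i)) ⬝ᵥ G.mulVec (rotatedBasis c (.inl i)) - G (.inl i) (.inl i) =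
      ((√(1 + ‖c i‖ ^ 2) : ℝ) : ℂ)⁻¹ * ((√(1 + ‖c i‖ ^ 2) : ℝ) : ℂ)⁻¹ *
        (c i * G (.inl i) (.inr i) + star (c i) * G (.inr i) (.inl i) +
          star (c i) * c i * (G (.inr i) (.inr i) - G (.inl i) (.inl i))) := by
  simp only [rotatedBasis]
  rw [smul_form_smul, sumElim_single_form, star_one]
  linear_combination G (.inl i) (.inl i) * inv_sqrt_mul_self (c i)

theorem rotatedBasis_form_inr [Fintype ι] [DecidableEq ι] (G : Matrix (ι ⊕ ι) (ι ⊕ ι) ℂ)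
    (c : ι → ℂ) (i : ι) :
    star (rotatedBasis c (.inr i)) ⬝ᵥ G.mulVec (rotatedBasis c (.inr i)) - G (.inr i) (.inr i) =
      -(((√(1 + ‖c i‖ ^ 2) : ℝ) : ℂ)⁻¹ * ((√(1 + ‖c i‖ ^ 2) : ℝ) : ℂ)⁻¹ *
        (c i * G (.inl i) (.inr i) + star (c i) * G (.inr i) (.inl i) +
          star (c i) * c i * (G (.inr i) (.inr i) - G (.inl i) (.inl i)))) := by
  simp only [rotatedBasis]
  rw [smul_form_smul, sumElim_single_form, star_one, star_neg, star_star]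
  linear_combination G (.inr i) (.inr i) * inv_sqrt_mul_self (c i)

/-- The form lemmas apply to `G = 1`, for which the quadratic equation holds for every `c`. -/
theorem rotatedBasis_orthonormal [Fintype ι] [DecidableEq ι] (c : ι → ℂ) (q q' : ι ⊕ ι) :
    star (rotatedBasis c q) ⬝ᵥ rotatedBasis c q' = if q = q' then 1 else 0 := by
  have h1 : star (rotatedBasis c q) ⬝ᵥ rotatedBasis c q' =
      star (rotatedBasis c q) ⬝ᵥ (1 : Matrix (ι ⊕ ι) (ι ⊕ ι) ℂ).mulVec (rotatedBasis c q') := by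
    rw [Matrix.one_mulVec]
  rw [h1]
  split_ifs with h
  · subst h
    rcases q with i | i
    · have h2 := rotatedBasis_form_inl (1 : Matrix (ι ⊕ ι) (ι ⊕ ι) ℂ) c i
      simpa [sub_eq_zero] using h2
    · have h2 := rotatedBasis_form_inr (1 : Matrix (ι ⊕ ι) (ι ⊕ ι) ℂ) c i
      simpa [sub_eq_zero] using h2
  · exact rotatedBasis_form_eq_zero
      (fun p q hpq => Matrix.one_apply_ne fun h => hpq (h ▸ rfl)) Matrix.isHermitian_one
      (fun i => by simp) h

end Rotation

/-! ### The singular value decomposition of the MSR operator -/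

theorem ModeIndex.sumElim_eq_of_order_eq {K : ℕ} {p q : ModeIndex K} (h : p.order = q.order) :
    Sum.elim id id p = (Sum.elim id id q : Fin (2 * K + 1)) := by
  rcases p with p | p <;> rcases q with q | q <;> exact modeOrder_injective K h

/-- The square of the asymptotic singular value is the squared norm of a column of `X` times the
asymptotic squared norm of a column of `Y`. -/
theorem msrSigma_eq (B : ElasticBackground) (K Ns Nr : ℕ) (R : ℝ) (p q : ModeIndex K) :
    msrSigma B K Ns Nr R p q =
      √(Ns * sourceModulus B p.mode ^ 2 * receiverNormSq B Nr R q) := by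
  have h1 : (Ns : ℝ) * sourceModulus B p.mode ^ 2 * receiverNormSq B Nr R q = Ns * Nr *
      (sourceModulus B p.mode * (B.κ q.mode * ‖deriv (hankel1 q.order) (B.κ q.mode * R)‖)) ^ 2 := by
    rw [receiverNormSq]; ring
  have h2 := (sourceModulus_pos B p.mode).le
  have h3 := (B.κ_pos q.mode).le
  rw [h1, Real.sqrt_mul (by positivity), Real.sqrt_sq (by positivity), msrSigma, sourceModulus]
  ring

theorem abs_sqrt_sub_one_le {u : ℝ} (hu : 0 ≤ u) : |√u - 1| ≤ |u - 1| := by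
  have h1 : u - 1 = (√u - 1) * (√u + 1) := by
    linear_combination -(Real.sq_sqrt hu)
  rw [h1, abs_mul]
  have h2 : 1 ≤ |√u + 1| := by
    rw [abs_of_nonneg (by positivity)]
    linarith [Real.sqrt_nonneg u]
  exact le_mul_of_one_le_right (abs_nonneg _) h2

theorem isBigO_inv_of_tendsto_mul {f : ℝ → ℝ} {L : ℝ} (hL : L ≠ 0)
    (h : Tendsto (fun R => R * f R) atTop (𝓝 L)) :
    (fun R => (f R)⁻¹) =O[atTop] fun R : ℝ => R := by
  have h1 := ((h.inv₀ hL).isBigO_one ℝ).mul (isBigO_refl (fun R : ℝ => R) atTop)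
  refine h1.congr' ?_ (by simp)
  filter_upwards [eventually_gt_atTop 0] with R hR
  rw [mul_inv]
  field_simp

theorem tendsto_mul_of_sub_isBigO {f g : ℝ → ℝ} {L : ℝ}
    (hfg : (fun R => f R - g R) =O[atTop] fun R : ℝ => (R ^ 2)⁻¹)
    (hg : Tendsto (fun R => R * g R) atTop (𝓝 L)) :
    Tendsto (fun R => R * f R) atTop (𝓝 L) := by
  have h1 : (fun R => R * (f R - g R)) =O[atTop] fun R : ℝ => R⁻¹ := by
    refine ((isBigO_refl (fun R : ℝ => R) atTop).mul hfg).congr' EventuallyEq.rfl ?_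
    filter_upwards [eventually_gt_atTop 0] with R hR
    field_simp
  simpa [mul_sub] using (h1.trans_tendsto tendsto_inv_atTop_zero).add hg

/-- For all large radii, the right singular vectors are the matrices `e_p w*` with `w` in a basis
obtained by a rotation by a small angle in each plane spanned by the `P` and `S` modes of the same
order. -/
theorem exists_isSVD_conjOperator {K : ℕ} {a c : Type*} [Fintype a] [Fintype c]
    {X : Matrix a (ModeIndex K) ℂ} {Y : ℝ → Matrix c (ModeIndex K) ℂ}
    {x : ModeIndex K → ℝ} {τ : ℝ → ModeIndex K → ℝ} {L : ModeIndex K → ℝ}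
    (hx : ∀ p, 0 < x p)
    (hX : ∀ p p', ∑ i, star (X i p) * X i p' = if p = p' then (x p : ℂ) else 0)
    (hY : ∀ᶠ R in atTop, ∀ p q : ModeIndex K, p.order ≠ q.order →
      ((Y R).conjTranspose * Y R) p q = 0)
    (hYτ : ∀ p q, (fun R => ((Y R).conjTranspose * Y R) p q -
      if p = q then (τ R q : ℂ) else 0) =O[atTop] fun R : ℝ => (R ^ 2)⁻¹)
    (hτ : ∀ q, Tendsto (fun R => R * τ R q) atTop (𝓝 (L q))) (hL : ∀ q, 0 < L q)
    (hLne : ∀ i, L (.inl i) ≠ L (.inr i)) :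
    ∃ (s : ℝ → ModeIndex K × ModeIndex K → ℝ)
      (U : ℝ → ModeIndex K × ModeIndex K → Matrix a c ℂ)
      (V : ℝ → ModeIndex K × ModeIndex K → Matrix (ModeIndex K) (ModeIndex K) ℂ),
      (∀ᶠ R : ℝ in atTop, IsSVD (conjOperator X (Y R)) (s R) (U R) (V R)) ∧
      (∀ p q k l : ModeIndex K,
        (fun R : ℝ => V R (p, q) k l - Matrix.single p q (1 : ℂ) k l)
          =O[atTop] fun R : ℝ => R⁻¹) ∧
      (∀ p q : ModeIndex K,
        (fun R : ℝ => s R (p, q) / √(x p * τ R q) - 1) =O[atTop] fun R : ℝ => R⁻¹) := by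
  set G : ℝ → Matrix (ModeIndex K) (ModeIndex K) ℂ := fun R => (Y R).conjTranspose * Y R with hG
  have hherm : ∀ R, (G R).IsHermitian := fun R => Matrix.isHermitian_conjTranspose_mul_self _
  choose rot hrot using exists_rotation_parameter
  set Δ : ℝ → Fin (2 * K + 1) → ℝ := fun R i => (G R (.inl i) (.inl i)).re -
    (G R (.inr i) (.inr i)).re with hΔ
  set cc : ℝ → Fin (2 * K + 1) → ℂ := fun R i => rot (Δ R i) (G R (.inl i) (.inr i)) with hcc
  have hdiag : ∀ R q, ((G R q q).re : ℂ) = G R q q := fun R q =>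
    Complex.conj_eq_iff_re.1 ((hherm R).apply q q)
  have hΔc : ∀ R i, ((Δ R i : ℝ) : ℂ) = G R (.inl i) (.inl i) - G R (.inr i) (.inr i) := fun R i =>
    (Complex.ofReal_sub _ _).trans (congrArg₂ _ (hdiag R _) (hdiag R _))
  have hGdiag : ∀ q, (fun R => (G R q q).re - τ R q) =O[atTop] fun R : ℝ => (R ^ 2)⁻¹ := by
    intro q
    rw [← Complex.isBigO_ofReal_left]
    refine (hYτ q q).congr_left fun R => ?_
    rw [if_pos rfl, Complex.ofReal_sub, hdiag]
  have hGlim : ∀ q, Tendsto (fun R => R * (G R q q).re) atTop (𝓝 (L q)) := fun q =>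
    tendsto_mul_of_sub_isBigO (hGdiag q) (hτ q)
  have hΔlim : ∀ i, Tendsto (fun R => R * Δ R i) atTop (𝓝 (L (.inl i) - L (.inr i))) := by
    intro i
    refine ((hGlim (.inl i)).sub (hGlim (.inr i))).congr fun R => ?_
    rw [hΔ]; ring
  have hΔne : ∀ᶠ R in atTop, ∀ i, Δ R i ≠ 0 := by
    rw [eventually_all]
    intro i
    filter_upwards [(hΔlim i).eventually_ne (sub_ne_zero.2 (hLne i))] with R hR h0
    exact hR (by rw [h0, mul_zero])
  have hoff : ∀ i, (fun R => G R (.inl i) (.inr i)) =O[atTop] fun R : ℝ => (R ^ 2)⁻¹ := fun i => by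
    simpa using hYτ (.inl i) (.inr i)
  have hoff' : ∀ i, (fun R => G R (.inr i) (.inl i)) =O[atTop] fun R : ℝ => (R ^ 2)⁻¹ := fun i => by
    simpa using hYτ (.inr i) (.inl i)
  -- The coupling `O(R^{-2})` is divided by a gap of exact order `R^{-1}`.
  have hcO : ∀ i, (fun R => cc R i) =O[atTop] fun R : ℝ => R⁻¹ := by
    intro i
    have h1 : (fun R => ‖G R (.inl i) (.inr i)‖ * |Δ R i|⁻¹) =O[atTop] fun R : ℝ => R⁻¹ := by
      have h2 := isBigO_inv_of_tendsto_mul (sub_ne_zero.2 (hLne i)) (hΔlim i)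
      refine ((hoff i).norm_left.mul (h2.norm_left)).congr' ?_ ?_
      · exact Eventually.of_forall fun R => congrArg _ (norm_inv (Δ R i))
      · filter_upwards [eventually_gt_atTop 0] with R hR
        field_simp
    refine IsBigO.trans (IsBigO.of_bound 1 ?_) h1
    filter_upwards [hΔne] with R hR
    rw [one_mul, Real.norm_of_nonneg (by positivity)]
    exact (hrot _ _ (hR i)).1
  set w : ℝ → ModeIndex K → ModeIndex K → ℂ := fun R => rotatedBasis (cc R) with hw
  set y : ℝ → ModeIndex K → ℝ := fun R q => (star (w R q) ⬝ᵥ (G R).mulVec (w R q)).re with hy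
  have hwy : ∀ R q, star (w R q) ⬝ᵥ (G R).mulVec (w R q) = (y R q : ℂ) := by
    intro R q
    refine (Complex.conj_eq_iff_re.1 ?_).symm
    exact Complex.conj_eq_iff_im.2 ((hherm R).im_star_dotProduct_mulVec_self (w R q))
  have hyG : ∀ q, (fun R => y R q - (G R q q).re) =O[atTop] fun R : ℝ => (R ^ 2)⁻¹ := by
    have hE : ∀ i, (fun R => cc R i * G R (.inl i) (.inr i) +
        star (cc R i) * G R (.inr i) (.inl i) + star (cc R i) * cc R i *
          (G R (.inr i) (.inr i) - G R (.inl i) (.inl i))) =O[atTop] fun R : ℝ => (R ^ 2)⁻¹ := by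
      intro i
      -- Boundedness of `c` suffices next to an off-diagonal entry; in the quadratic term one factor
      -- `c` and the gap supply `R^{-1}` each.
      have h1 : (fun R => cc R i) =O[atTop] fun _ : ℝ => (1 : ℝ) :=
        (hcO i).trans (tendsto_inv_atTop_zero.isBigO_one ℝ)
      have h2 : (fun R => G R (.inr i) (.inr i) - G R (.inl i) (.inl i)) =O[atTop]
          fun R : ℝ => R⁻¹ := by
        have h3 := ((hΔlim i).isBigO_one ℝ).mul (isBigO_refl (fun R : ℝ => R⁻¹) atTop)
        refine (Complex.isBigO_ofReal_left.2 h3).neg_left.congr' ?_ (by simp)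
        filter_upwards [eventually_gt_atTop 0] with R hR
        rw [mul_comm R, mul_inv_cancel_right₀ hR.ne', hΔc, neg_sub]
      have h4 : (fun R => cc R i * (G R (.inr i) (.inr i) - G R (.inl i) (.inl i))) =O[atTop]
          fun R : ℝ => (R ^ 2)⁻¹ :=
        ((hcO i).mul h2).congr_right fun R => by rw [← mul_inv, sq]
      refine (((h1.mul (hoff i)).add ((isBigO_star h1).mul (hoff' i))).add
        ((isBigO_star h1).mul h4)).congr (fun R => by rw [mul_assoc (star (cc R i))])
        fun R => one_mul _
    have hN : ∀ i R, ‖((√(1 + ‖cc R i‖ ^ 2) : ℝ) : ℂ)⁻¹ * ((√(1 + ‖cc R i‖ ^ 2) : ℝ) : ℂ)⁻¹‖ ≤ 1 :=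
      fun i R => by
        have h1 : ‖((√(1 + ‖cc R i‖ ^ 2) : ℝ) : ℂ)⁻¹‖ ≤ 1 := by
          rw [norm_inv, Complex.norm_real, Real.norm_of_nonneg (Real.sqrt_nonneg _)]
          exact inv_le_one_of_one_le₀ (one_le_sqrt_one_add _)
        rw [norm_mul]
        exact mul_le_one₀ h1 (norm_nonneg _) h1
    have hcast : ∀ R q, ((y R q - (G R q q).re : ℝ) : ℂ) =
        star (w R q) ⬝ᵥ (G R).mulVec (w R q) - G R q q := fun R q =>
      (Complex.ofReal_sub _ _).trans (congrArg₂ _ (hwy R q).symm (hdiag R q))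
    intro q
    rw [← Complex.isBigO_ofReal_left]
    rcases q with i | i
    · refine IsBigO.trans (IsBigO.of_bound 1 (Eventually.of_forall fun R => ?_)) (hE i)
      rw [hcast, rotatedBasis_form_inl, norm_mul]
      exact mul_le_mul_of_nonneg_right (hN i R) (norm_nonneg _)
    · refine IsBigO.trans (IsBigO.of_bound 1 (Eventually.of_forall fun R => ?_)) (hE i)
      rw [hcast, rotatedBasis_form_inr, norm_neg, norm_mul]
      exact mul_le_mul_of_nonneg_right (hN i R) (norm_nonneg _)
  have hyτ : ∀ q, (fun R => y R q - τ R q) =O[atTop] fun R : ℝ => (R ^ 2)⁻¹ := fun q =>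
    ((hyG q).add (hGdiag q)).congr_left fun R => by ring
  have hpos : ∀ {f : ℝ → ModeIndex K → ℝ}, (∀ q, Tendsto (fun R => R * f R q) atTop (𝓝 (L q))) →
      ∀ᶠ R in atTop, ∀ q, 0 < f R q := by
    intro f hf
    rw [eventually_all]
    intro q
    filter_upwards [(hf q).eventually (lt_mem_nhds (hL q)), eventually_gt_atTop 0] with R h1 h2
    exact pos_of_mul_pos_right h1 h2.le
  have hypos := hpos fun q => tendsto_mul_of_sub_isBigO (hyτ q) (hτ q)
  have hτpos := hpos hτ
  -- The formulas are taken for all `R`; they form a decomposition once the gaps are nonzero and the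
  -- values `y` positive.
  refine ⟨fun R i => √(x i.1 * y R i.2), fun R i => (((√(x i.1 * y R i.2))⁻¹ : ℝ) : ℂ) •
    conjOperator X (Y R) (rankOneMatrix i.1 (w R i.2)), fun R i => rankOneMatrix i.1 (w R i.2),
    ?_, fun p q k l => ?_, fun p q => ?_⟩
  · filter_upwards [hypos, hY, hΔne] with R h1 h2 h3
    refine isSVD_conjOperator hx h1 hX (rotatedBasis_orthonormal (cc R)) fun q q' => ?_
    split_ifs with h
    · subst h
      exact hwy R q
    · refine rotatedBasis_form_eq_zero (fun p q hpq => h2 p q fun ho =>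
        hpq (ModeIndex.sumElim_eq_of_order_eq ho)) (hherm R) (fun i => ?_) h
      have h4 := (hrot _ (G R (.inl i) (.inr i)) (h3 i)).2
      rw [hΔc] at h4
      exact h4
  · refine IsBigO.trans (IsBigO.of_bound 1 (Eventually.of_forall fun R => ?_))
      (hcO (Sum.elim id id q))
    rw [one_mul, ← rankOneMatrix_single]
    simp only [rankOneMatrix, Matrix.of_apply]
    split_ifs with hk
    · rw [← star_sub, norm_star]
      exact norm_rotatedBasis_sub_le _ _ _
    · simp
  · have h1 : (fun R => (y R q - τ R q) * (τ R q)⁻¹) =O[atTop] fun R : ℝ => R⁻¹ := by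
      refine ((hyτ q).mul (isBigO_inv_of_tendsto_mul (hL q).ne' (hτ q))).congr'
        EventuallyEq.rfl ?_
      filter_upwards [eventually_gt_atTop 0] with R hR
      field_simp
    refine IsBigO.trans (IsBigO.of_bound 1 ?_) h1
    filter_upwards [hypos, hτpos] with R hy0 hτ0
    have hxp := hx p
    have hyq := hy0 q
    have hτq := hτ0 q
    -- The source factor cancels in the ratio, leaving `√(y/τ)`, and the square root does not
    -- increase the distance to `1`.
    rw [one_mul, ← Real.sqrt_div (by positivity), mul_div_mul_left _ _ hxp.ne', sub_mul,
      mul_inv_cancel₀ hτq.ne', ← div_eq_mul_inv]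
    exact abs_sqrt_sub_one_le (by positivity)

theorem theorem4p4 (B : ElasticBackground) (K Ns Nr : ℕ)
    (hNs : 2 * K + 1 ≤ Ns) (hNr : 2 * K + 1 ≤ Nr) (δ : ℝ)
    (d dperp : Fin Nr → Plane) (hd : ∀ r, ‖d r‖ = 1) (hdperp : ∀ r, ‖dperp r‖ = 1)
    (horth : ∀ r, inner ℝ (d r) (dperp r) = 0) :
    (∀ p q p' q' : ModeIndex K,
      (fun R : ℝ =>
        frobeniusInner (msrOperator B K Ns Nr δ d dperp R (Matrix.single p q 1))
            (msrOperator B K Ns Nr δ d dperp R (Matrix.single p' q' 1)) -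
          (if p = p' ∧ q = q' then ((msrSigma B K Ns Nr R p q ^ 2 : ℝ) : ℂ) else 0))
        =O[atTop] fun R : ℝ => (R ^ 2)⁻¹) ∧
    ∃ (s : ℝ → ModeIndex K × ModeIndex K → ℝ)
      (U : ℝ → ModeIndex K × ModeIndex K → Matrix (Fin Ns ⊕ Fin Ns) (Fin Nr ⊕ Fin Nr) ℂ)
      (V : ℝ → ModeIndex K × ModeIndex K → Matrix (ModeIndex K) (ModeIndex K) ℂ),
      (∀ᶠ R : ℝ in atTop, IsSVD (msrOperator B K Ns Nr δ d dperp R) (s R) (U R) (V R)) ∧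
      (∀ p q k l : ModeIndex K,
        (fun R : ℝ => V R (p, q) k l - Matrix.single p q (1 : ℂ) k l)
          =O[atTop] fun R : ℝ => R⁻¹) ∧
      (∀ p q : ModeIndex K,
        (fun R : ℝ => s R (p, q) / msrSigma B K Ns Nr R p q - 1)
          =O[atTop] fun R : ℝ => R⁻¹) := by
  have hNs0 : (0 : ℝ) < Ns := by exact_mod_cast (by omega : 0 < Ns)
  have hNr0 : (0 : ℝ) < Nr := by exact_mod_cast (by omega : 0 < Nr)
  have hYO : ∀ p q, (fun R => ((receiverMatrix B K Nr R d dperp).conjTranspose *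
      receiverMatrix B K Nr R d dperp) p q - if p = q then (receiverNormSq B Nr R q : ℂ) else 0)
      =O[atTop] fun R : ℝ => (R ^ 2)⁻¹ := fun p q =>
    receiverMatrix_gram_sub_isBigO B hNr hd hdperp horth p q
  refine ⟨fun p q p' q' => ?_, ?_⟩
  -- The receiver entry is `(q', q)` because the vector in `e_p w*` enters conjugated. The source
  -- Gram entry is exact, so the error is a constant multiple of the receiver error.
  · have h1 := (hYO q' q).const_mul_left
      (if p = p' then ((Ns * sourceModulus B p.mode ^ 2 : ℝ) : ℂ) else 0)
    refine h1.congr_left fun R => ?_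
    rw [msrOperator, ← rankOneMatrix_single, ← rankOneMatrix_single,
      frobeniusInner_conjOperator_rankOneMatrix, sourceMatrix_gram B hNs, mul_sub]
    congr 1
    · congr 1
      rw [← Pi.single_star, star_one, single_one_dotProduct, Matrix.mulVec_single_one]
      rfl
    · have hnn : 0 ≤ Ns * sourceModulus B p.mode ^ 2 * receiverNormSq B Nr R q := by
        rw [receiverNormSq]; positivity
      rw [msrSigma_eq, Real.sq_sqrt hnn]
      by_cases hp : p = p' <;> by_cases hq : q = q' <;> simp [hp, hq, Ne.symm]
  · have hκ : ∀ i : Fin (2 * K + 1), Nr * B.κ (ModeIndex.mode (.inl i : ModeIndex K)) * (2 / π) ≠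
        Nr * B.κ (ModeIndex.mode (.inr i : ModeIndex K)) * (2 / π) := fun i => by
      refine ne_of_lt ?_
      have h1 := B.κ_P_lt_κ_S
      have h2 : 0 < 2 / π := by positivity
      gcongr
      exact h1
    have hmod := fun α => sourceModulus_pos B α
    have hκp := fun α => B.κ_pos α
    obtain ⟨s, U, V, h1, h2, h3⟩ := exists_isSVD_conjOperator
      (X := sourceMatrix B K Ns δ) (Y := fun R => receiverMatrix B K Nr R d dperp)
      (x := fun p => Ns * sourceModulus B p.mode ^ 2)
      (τ := fun R q => receiverNormSq B Nr R q)
      (fun p => mul_pos hNs0 (pow_pos (hmod _) 2)) (sourceMatrix_gram B hNs δ)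
      (by
        filter_upwards [eventually_gt_atTop 0, eventually_differentiableAt_hankel1_modes B K]
          with R hR hH p q hpq
        exact (receiverMatrix_gram B hNr hd hdperp horth hR hH p q).trans (if_neg hpq))
      hYO (tendsto_mul_receiverNormSq B Nr)
      (fun q => mul_pos (mul_pos hNr0 (hκp _)) (by positivity)) hκ
    refine ⟨s, U, V, h1, h2, fun p q => (h3 p q).congr_left fun R => ?_⟩
    rw [msrSigma_eq]
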